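/- Let $m,n\ge 0$ be integers, let $M\in\mathbb R^{n\times n}$ be symmetric positive definite, let $G\in\mathbb R^{n\times m}$ have rank $m$, and let $V(q)=\tfrac12 q^TSq$ be a quadratic form on $\mathbb R^n$ ($S$ symmetric). Consider the linear controlled Hamiltonian system with input $u\in\mathbb R^m$ $$\dot q=\partial_pH,\qquad \dot p=-\partial_qH+Gu,\qquad H(q,p)=\tfrac12p^TM^{-1}p+V(q), \tag{1}$$ that is, $\dot x=Ax+Bu$ with $x=(q,p)$, $A=\begin{bmatrix}0&M^{-1}\\-S&0\end{bmatrix}$, $B=\begin{bmatrix}0\\G\end{bmatrix}$. Say that (1) is transformed to the desired form with data $(\widehat M,\widehat V,K_v)$ if $\widehat M$ is a constant symmetric positive definite $n\times n$ matrix, $\widehat V$ is a positive definite quadratic form on $\mathbb R^n$, $K_v(q)$ is a symmetric positive definite $m\times m$ matrix depending smoothly on $q$, and there is a smooth feedback law $u=u(q,p)$ under which (1) becomes $$\begin{bmatrix}\dot q\\ \dot p\end{bmatrix}=\begin{bmatrix}0&M^{-1}\widehat M\\-\widehat MM^{-1}&-GK_v(q)G^T\end{bmatrix}\begin{bmatrix}\partial_q\widehat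 H\\ \partial_p\widehat H\end{bmatrix},\qquad \widehat H(q,p)=\tfrac12p^T\widehat M^{-1}p+\widehat V(q) \tag{2}$$ (so that there is no gyroscopic force, $C=0$). System (1) is controllable if every state can be steered to every other state in finite time. Its uncontrollable dynamics are $\dot z=A_{22}z$, where $A_{22}$ is the map induced by $A$ on the quotient of $\mathbb R^{2n}$ by the controllable subspace $\sum_{k\ge0}\operatorname{im}(A^kB)$. A linear dynamics $\dot z=Fz$ is oscillatory if $F$ is diagonalizable over $\mathbb C$ and each eigenvalue of $F$ is a non-zero purely imaginary number. Then: 1. System (1) can be transformed to the desired form (2) with some data $(\widehat M,\widehat V,K_v)$ if and only if (1) is controllable or its uncontrollable dynamics are oscillatory. The same equivalence holds if $K_v$ is required to be constant. 2. Whenever (1) is transformed to the desired form (2) with data $(\widehat M,\widehat V,K_v)$, the origin is an exponentially stable equilibrium of the closed-loop system (2) if and only if (1) is controllable. If $K_v$ is constant, so that (2) is linear, the same equivalence holds with global exponential stability. -/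

import Mathlib

open scoped Matrix ContDiff TensorProduct

noncomputable section

namespace IDAPBC

/-- Configuration vectors (and momenta) in `ℝⁿ`. -/
abbrev Vec (n : ℕ) : Type := Fin n → ℝ

/-- The phase space of pairs `(q, p)`. -/
abbrev Phase (n : ℕ) : Type := Vec n × Vec n

/-- The column vector of partial derivatives of `f` at `x`. -/
def grad {n : ℕ} (f : Vec n → ℝ) (x : Vec n) : Vec n :=
  fun i => fderiv ℝ f x (Pi.single i 1)

/-- The Hamiltonian `H(q,p) = ½ pᵀ M(q)⁻¹ p + V(q)`. -/
def hamiltonian {n : ℕ} (M : Vec n → Matrix (Fin n) (Fin n) ℝ) (V : Vec n → ℝ)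
    (q p : Vec n) : ℝ :=
  (1 / 2) * (p ⬝ᵥ ((M q)⁻¹ *ᵥ p)) + V q

/-- The partial gradient of `H` in the position variable. -/
def gradQ {n : ℕ} (H : Vec n → Vec n → ℝ) (q p : Vec n) : Vec n :=
  grad (fun q' => H q' p) q

/-- The partial gradient of `H` in the momentum variable. -/
def gradP {n : ℕ} (H : Vec n → Vec n → ℝ) (q p : Vec n) : Vec n :=
  grad (fun p' => H q p') p

/-- The right-hand side of the controlled Hamiltonian system
`q' = ∂H/∂p`, `p' = -∂H/∂q + G(q) u`. -/
def hamField {n m : ℕ} (M : Vec n → Matrix (Fin n) (Fin n) ℝ) (V : Vec n → ℝ)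
    (G : Vec n → Matrix (Fin n) (Fin m) ℝ) (x : Phase n) (u : Vec m) : Phase n :=
  (gradP (hamiltonian M V) x.1 x.2,
    -gradQ (hamiltonian M V) x.1 x.2 + G x.1 *ᵥ u)

/-- The gyroscopic force with components
`∑ i j, C i j k * (Mhat⁻¹ p) i * (Mhat⁻¹ p) j`. -/
def gyroForce {n : ℕ} (Mhat : Vec n → Matrix (Fin n) (Fin n) ℝ)
    (C : Vec n → Fin n → Fin n → Fin n → ℝ) (q p : Vec n) : Vec n :=
  fun k => ∑ i, ∑ j, C q i j k * ((Mhat q)⁻¹ *ᵥ p) i * ((Mhat q)⁻¹ *ᵥ p) j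

/-- The right-hand side of the desired closed-loop system
`q' = M⁻¹ Mhat ∂Hhat/∂p`,
`p' = -Mhat M⁻¹ ∂Hhat/∂q - G Kv Gᵀ ∂Hhat/∂p + (gyroscopic force of C)`,
where `Hhat = ½ pᵀ Mhat⁻¹ p + Vhat`. -/
def desiredField {n m : ℕ} (M : Vec n → Matrix (Fin n) (Fin n) ℝ)
    (G : Vec n → Matrix (Fin n) (Fin m) ℝ) (Mhat : Vec n → Matrix (Fin n) (Fin n) ℝ)
    (Vhat : Vec n → ℝ) (Kv : Vec n → Matrix (Fin m) (Fin m) ℝ)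
    (C : Vec n → Fin n → Fin n → Fin n → ℝ) (x : Phase n) : Phase n :=
  (((M x.1)⁻¹ * Mhat x.1) *ᵥ gradP (hamiltonian Mhat Vhat) x.1 x.2,
    -((Mhat x.1 * (M x.1)⁻¹) *ᵥ gradQ (hamiltonian Mhat Vhat) x.1 x.2)
      - (G x.1 * Kv x.1 * (G x.1)ᵀ) *ᵥ gradP (hamiltonian Mhat Vhat) x.1 x.2
      + gyroForce Mhat C x.1 x.2)

/-- The vector field of the linear controlled Hamiltonian system with constant mass matrix `M`,
constant input matrix `G` and quadratic potential `V`. -/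
def linHamField {n m : ℕ} (M : Matrix (Fin n) (Fin n) ℝ) (V : QuadraticForm ℝ (Vec n))
    (G : Matrix (Fin n) (Fin m) ℝ) : Phase n → Vec m → Phase n :=
  hamField (fun _ => M) V (fun _ => G)

/-- The desired closed-loop vector field with constant `M`, `G`, `Mhat`, quadratic `Vhat`
and no gyroscopic force. -/
def linDesiredField {n m : ℕ} (M : Matrix (Fin n) (Fin n) ℝ) (G : Matrix (Fin n) (Fin m) ℝ)
    (Mhat : Matrix (Fin n) (Fin n) ℝ) (Vhat : QuadraticForm ℝ (Vec n))
    (Kv : Vec n → Matrix (Fin m) (Fin m) ℝ) : Phase n → Phase n :=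
  desiredField (fun _ => M) (fun _ => G) (fun _ => Mhat) Vhat Kv 0

/-- Some smooth feedback law `u = u(q,p)` transforms the linear controlled Hamiltonian system
to the desired form with a constant positive definite symmetric `Mhat`, a positive definite
quadratic `Vhat`, a smooth field `Kv` of positive definite symmetric matrices, and `C = 0`. -/
structure TransformsTo {n m : ℕ} (M : Matrix (Fin n) (Fin n) ℝ) (V : QuadraticForm ℝ (Vec n))
    (G : Matrix (Fin n) (Fin m) ℝ) (Mhat : Matrix (Fin n) (Fin n) ℝ)
    (Vhat : QuadraticForm ℝ (Vec n)) (Kv : Vec n → Matrix (Fin m) (Fin m) ℝ) : Prop where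
  posDef_Mhat : Mhat.PosDef
  posDef_Vhat : Vhat.PosDef
  smooth_Kv : ∀ i j, ContDiff ℝ ∞ (fun q => Kv q i j)
  posDef_Kv : ∀ q, (Kv q).PosDef
  exists_feedback : ∃ u : Phase n → Vec m, ContDiff ℝ ∞ u ∧
    ∀ x, linHamField M V G x (u x) = linDesiredField M G Mhat Vhat Kv x

/-- Controllability: any state can be steered to any other state in finite time by a
continuous input. -/
def Controllable {X U : Type*} [NormedAddCommGroup X] [NormedSpace ℝ X] [TopologicalSpace U]
    (F : X → U → X) : Prop :=
  ∀ x₀ x₁ : X, ∃ T : ℝ, 0 < T ∧ ∃ (u : ℝ → U) (x : ℝ → X),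
    ContinuousOn u (Set.Icc 0 T) ∧
    (∀ t ∈ Set.Icc 0 T, HasDerivWithinAt x (F (x t) (u t)) (Set.Icc 0 T) t) ∧
    x 0 = x₀ ∧ x T = x₁

/-- `x` solves `x' = f x` on `[0, T]`. -/
def IsSolution {X : Type*} [NormedAddCommGroup X] [NormedSpace ℝ X]
    (f : X → X) (T : ℝ) (x : ℝ → X) : Prop :=
  ∀ t ∈ Set.Icc 0 T, HasDerivWithinAt x (f (x t)) (Set.Icc 0 T) t

/-- (Local) exponential stability of the origin for `x' = f x`: the exponential estimate holds
along every solution that starts close enough to the origin, as long as it exists. -/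
def ExpStable {X : Type*} [NormedAddCommGroup X] [NormedSpace ℝ X] (f : X → X) : Prop :=
  ∃ δ > 0, ∃ c > 0, ∃ lam > 0, ∀ (T : ℝ) (x : ℝ → X), IsSolution f T x → ‖x 0‖ < δ →
    ∀ t ∈ Set.Icc 0 T, ‖x t‖ ≤ c * Real.exp (-lam * t) * ‖x 0‖

/-- Global exponential stability of the origin for `x' = f x`. -/
def GlobExpStable {X : Type*} [NormedAddCommGroup X] [NormedSpace ℝ X] (f : X → X) : Prop :=
  ∃ c > 0, ∃ lam > 0, ∀ (T : ℝ) (x : ℝ → X), IsSolution f T x →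
    ∀ t ∈ Set.Icc 0 T, ‖x t‖ ≤ c * Real.exp (-lam * t) * ‖x 0‖

section LinearSystems

variable {X U : Type*} [AddCommGroup X] [Module ℝ X] [AddCommGroup U] [Module ℝ U]

/-- The controllable subspace `im B + im AB + im A²B + ⋯` of `x' = A x + B u`. -/
def controllableSubspace (A : X →ₗ[ℝ] X) (B : U →ₗ[ℝ] X) : Submodule ℝ X :=
  ⨆ k : ℕ, LinearMap.range ((A ^ k) ∘ₗ B)

theorem controllableSubspace_le_comap (A : X →ₗ[ℝ] X) (B : U →ₗ[ℝ] X) :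
    controllableSubspace A B ≤ (controllableSubspace A B).comap A := by
  refine iSup_le fun k => ?_
  rintro _ ⟨u, rfl⟩
  refine (le_iSup (fun k : ℕ => LinearMap.range ((A ^ k) ∘ₗ B)) (k + 1)) ⟨u, ?_⟩
  simp [pow_succ']

/-- The uncontrollable dynamics of `x' = A x + B u`: the map that `A` induces on the quotient
by the controllable subspace, that is, the block `A₂₂` of the Kalman decomposition. -/
def uncontrollableDynamics (A : X →ₗ[ℝ] X) (B : U →ₗ[ℝ] X) :
    Module.End ℝ (X ⧸ controllableSubspace A B) :=
  (controllableSubspace A B).mapQ (controllableSubspace A B) A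
    (controllableSubspace_le_comap A B)

/-- The linear dynamics `x' = A x` is oscillatory: `A` is diagonalizable over `ℂ`, and each of
its eigenvalues is a non-zero purely imaginary number. -/
def Oscillatory (A : Module.End ℝ X) : Prop :=
  (⨆ μ : ℂ, Module.End.eigenspace (LinearMap.baseChange ℂ A) μ) = ⊤ ∧
  ∀ μ : ℂ, Module.End.HasEigenvalue (LinearMap.baseChange ℂ A) μ → μ.re = 0 ∧ μ ≠ 0

end LinearSystems

/-- The second-derivative matrix of a quadratic function. -/
def hess {n : ℕ} (V : QuadraticForm ℝ (Vec n)) : Matrix (Fin n) (Fin n) ℝ :=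
  Matrix.of fun i j => QuadraticMap.polar V (Pi.single i 1) (Pi.single j 1)

/-- The state matrix `(q, p) ↦ (M⁻¹ p, - D²V q)` of the linear controlled Hamiltonian system. -/
def stateMap {n : ℕ} (M : Matrix (Fin n) (Fin n) ℝ) (V : QuadraticForm ℝ (Vec n)) :
    Phase n →ₗ[ℝ] Phase n :=
  LinearMap.prod ((M⁻¹).mulVecLin ∘ₗ LinearMap.snd ℝ (Vec n) (Vec n))
    (-((hess V).mulVecLin ∘ₗ LinearMap.fst ℝ (Vec n) (Vec n)))

/-- The input matrix `u ↦ (0, G u)` of the linear controlled Hamiltonian system. -/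
def inputMap {n m : ℕ} (G : Matrix (Fin n) (Fin m) ℝ) : Vec m →ₗ[ℝ] Phase n :=
  LinearMap.inr ℝ (Vec n) (Vec n) ∘ₗ G.mulVecLin

theorem grad_add_const {n : ℕ} (f : Vec n → ℝ) (c : ℝ) (x : Vec n) :
    grad (fun y => c + f y) x = grad f x := by
  funext i
  simp [grad]

theorem grad_quadratic {n : ℕ} (V : QuadraticForm ℝ (Vec n)) (x : Vec n) :
    grad V x = hess V *ᵥ x := by
  have key : ∀ y, V y = (1 / 2) * (QuadraticMap.polarBilin V y y) := by
    intro y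
    simp [QuadraticMap.polar_self]
  let b : Vec n →L[ℝ] Vec n →L[ℝ] ℝ :=
    LinearMap.toContinuousLinearMap
      (LinearMap.toContinuousLinearMap.toLinearMap ∘ₗ QuadraticMap.polarBilin V)
  have hb : ∀ y z, b y z = QuadraticMap.polar V y z := fun y z => rfl
  have hV : (V : Vec n → ℝ) = fun y => (1 / 2) * (b y y) := by
    funext y
    rw [key y, hb]
    rfl
  have hd : HasFDerivAt (V : Vec n → ℝ) (((1 / 2 : ℝ)) • (b x + b.flip x)) x := by
    rw [hV]
    have h := (b.hasFDerivAt (x := x)).clm_apply (hasFDerivAt_id x)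
    refine (h.const_mul (1 / 2 : ℝ)).congr_fderiv ?_
    ext v
    simp
  funext i
  have hx : QuadraticMap.polar V (Pi.single i 1) x
      = ∑ j, QuadraticMap.polar V (Pi.single i 1) (Pi.single j 1) * x j := by
    have h := LinearMap.pi_apply_eq_sum_univ (QuadraticMap.polarBilin V (Pi.single i 1)) x
    simp only [QuadraticMap.polarBilin_apply_apply, smul_eq_mul] at h
    rw [h]
    refine Finset.sum_congr rfl fun j _ => ?_
    rw [mul_comm]
    congr 2
    funext k
    simp [Pi.single_apply, eq_comm]
  simp only [grad, hd.fderiv]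
  simp only [smul_apply, add_apply,
    ContinuousLinearMap.flip_apply, hb, smul_eq_mul]
  rw [QuadraticMap.polar_comm V x, hx]
  simp only [Matrix.mulVec, dotProduct, hess, Matrix.of_apply]
  ring

theorem grad_kinetic {n : ℕ} (N : Matrix (Fin n) (Fin n) ℝ) (hN : N.IsSymm) (p : Vec n) :
    grad (fun p' => (1 / 2) * (p' ⬝ᵥ (N *ᵥ p'))) p = N *ᵥ p := by
  have h1 : (fun p' : Vec n => (1 / 2) * (p' ⬝ᵥ (N *ᵥ p')))
      = (((1 / 2 : ℝ) • N.toQuadraticForm' : QuadraticForm ℝ (Vec n)) : Vec n → ℝ) := by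
    funext y
    simp [Matrix.toQuadraticForm', Matrix.toLinearMap₂'_apply', dotProduct]
  rw [h1, grad_quadratic]
  congr 1
  ext i j
  have hs : N j i = N i j := hN.apply i j
  simp only [hess, Matrix.of_apply, QuadraticMap.polar, ← h1]
  simp [Matrix.mulVec_add, hs]
  ring

/-- For constant symmetric `M` and quadratic `V` the system is `x' = A x + B u` with
`A = stateMap M V` and `B = inputMap G`. -/
theorem linHamField_eq {n m : ℕ} (M : Matrix (Fin n) (Fin n) ℝ) (hM : M.IsSymm)
    (V : QuadraticForm ℝ (Vec n)) (G : Matrix (Fin n) (Fin m) ℝ) (x : Phase n) (u : Vec m) :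
    linHamField M V G x u = stateMap M V x + inputMap G u := by
  have hp : gradP (hamiltonian (fun _ => M) V) x.1 x.2 = M⁻¹ *ᵥ x.2 := by
    rw [← grad_kinetic M⁻¹ (by rw [Matrix.IsSymm, Matrix.transpose_nonsing_inv, hM]) x.2]
    funext i
    simp [gradP, grad, hamiltonian]
  have hq : gradQ (hamiltonian (fun _ => M) V) x.1 x.2 = hess V *ᵥ x.1 := by
    rw [← grad_quadratic]
    exact grad_add_const _ _ _
  ext i <;> simp [linHamField, hamField, hp, hq, stateMap, inputMap]

end IDAPBC

end

open scoped Matrix ContDiff TensorProduct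

noncomputable section

namespace IDAPBC

/-! Write S = `hess V`, Ŝ = `hess Vhat`, M̂ = `Mhat`. Everything is decided by the modes S x = e M
x, x ≠ 0; call such a mode hidden if Gᵀ x = 0. A covector killing the controllable subspace is a
pair of vectors all of whose modal components lie in ker Gᵀ, and a hidden mode at e puts the
eigenvalues ±√(-e) into the quotient. Hence controllability means that no mode is hidden
(`controllable_iff_noHiddenMode`), while "controllable or oscillatory" means that every hidden mode
has e > 0 (`controllable_or_oscillatory_iff`).

Feedback only changes forces in im G, so transformability comes down to S - M̂ M⁻¹ Ŝ = G F for some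
F. Evaluated on a hidden mode this gives e (Mx)ᵀ Ŝ⁻¹ (Mx) = xᵀ M̂ x, so e > 0
(`TransformsTo.noHiddenMode`). Conversely, in modal coordinates M becomes 1, S becomes D = diag(a),
G becomes B, and the task is to find X, Y > 0 and W with D Y = X - B W. With R_s = (s - D)⁻¹ for n
values s > 0 off the spectrum, take Y = ∑ R_s B Bᵀ R_s + D₊, where D₊ is the positive part of D.
Since D R_s = s R_s - 1, this gives X = ∑ s R_s B Bᵀ R_s + D D₊. Both are semidefinite, and a kernel
could only come from hidden modes with e ≤ 0 (`exists_transformsTo`).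

For stability, a hidden mode survives as an undamped periodic motion of the closed loop. If there is
none, the damping output is observable for the undamped closed loop (`TransformsTo.observable`), and
a large multiple of the energy plus a correction is a strict quadratic Lyapunov function
(`exists_strict_lyapunov`). -/

/-! ### Positive definite matrices, quadratic forms and the closed loop in matrix form. -/

theorem hess_isSymm {n : ℕ} (V : QuadraticForm ℝ (Vec n)) : (hess V).IsSymm := by
  ext i j
  simp [hess, QuadraticMap.polar_comm V (Pi.single j 1)]

theorem polar_eq_hess {n : ℕ} (V : QuadraticForm ℝ (Vec n)) (x y : Vec n) :
    QuadraticMap.polar V x y = x ⬝ᵥ (hess V *ᵥ y) := by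
  have h2 : QuadraticMap.polarBilin V = Matrix.toLinearMap₂' ℝ (hess V) := by
    apply (LinearMap.toMatrix₂' ℝ).injective
    rw [LinearMap.toMatrix'_toLinearMap₂']
    ext i j
    simp [hess, LinearMap.toMatrix₂'_apply]
  rw [← QuadraticMap.polarBilin_apply_apply, h2, Matrix.toLinearMap₂'_apply']

theorem quadraticForm_eq_hess {n : ℕ} (V : QuadraticForm ℝ (Vec n)) (x : Vec n) :
    V x = (1 / 2) * (x ⬝ᵥ (hess V *ᵥ x)) := by
  rw [← polar_eq_hess, QuadraticMap.polar_self]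
  simp

theorem posDef_of_dotProduct {n : ℕ} {A : Matrix (Fin n) (Fin n) ℝ} (hA : A.IsSymm)
    (h : ∀ x, x ≠ 0 → 0 < x ⬝ᵥ (A *ᵥ x)) : A.PosDef :=
  Matrix.PosDef.of_dotProduct_mulVec_pos (by simpa [Matrix.IsHermitian] using hA.eq)
    fun x hx => by simpa using h x hx

theorem dotProduct_pos_of_posDef {n : ℕ} {A : Matrix (Fin n) (Fin n) ℝ} (hA : A.PosDef)
    {x : Vec n} (hx : x ≠ 0) : 0 < x ⬝ᵥ (A *ᵥ x) := by
  simpa using hA.dotProduct_mulVec_pos hx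

theorem isSymm_of_posDef {n : ℕ} {A : Matrix (Fin n) (Fin n) ℝ} (hA : A.PosDef) : A.IsSymm := by
  simpa [Matrix.IsHermitian, Matrix.IsSymm] using hA.isHermitian

theorem hess_posDef {n : ℕ} {V : QuadraticForm ℝ (Vec n)} (hV : V.PosDef) : (hess V).PosDef :=
  posDef_of_dotProduct (hess_isSymm V) fun x hx => by
    have := hV x hx
    rw [quadraticForm_eq_hess] at this
    linarith

/-- Every positive definite symmetric matrix is the second derivative of a positive definite
quadratic form. -/
theorem exists_quadraticForm_hess_eq {n : ℕ} {A : Matrix (Fin n) (Fin n) ℝ} (hA : A.PosDef) :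
    ∃ V : QuadraticForm ℝ (Vec n), V.PosDef ∧ hess V = A := by
  have hV : ∀ x, ((1 / 2 : ℝ) • A.toQuadraticForm' : QuadraticForm ℝ (Vec n)) x
      = (1 / 2) * (x ⬝ᵥ (A *ᵥ x)) := by
    intro y
    simp [Matrix.toQuadraticForm', Matrix.toLinearMap₂'_apply', dotProduct]
  refine ⟨(1 / 2 : ℝ) • A.toQuadraticForm', fun x hx => ?_, ?_⟩
  · rw [hV]
    have := dotProduct_pos_of_posDef hA hx
    linarith
  · ext i j
    have hs : A j i = A i j := (isSymm_of_posDef hA).apply i j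
    simp only [hess, Matrix.of_apply, QuadraticMap.polar, hV]
    simp [Matrix.mulVec_add, hs]
    ring

theorem mulVec_inv_mulVec {n : ℕ} {A : Matrix (Fin n) (Fin n) ℝ} (hA : A.PosDef) (x : Vec n) :
    A *ᵥ (A⁻¹ *ᵥ x) = x := by
  rw [Matrix.mulVec_mulVec, Matrix.mul_nonsing_inv _ hA.det_pos.ne'.isUnit, Matrix.one_mulVec]

theorem inv_mulVec_mulVec {n : ℕ} {A : Matrix (Fin n) (Fin n) ℝ} (hA : A.PosDef) (x : Vec n) :
    A⁻¹ *ᵥ (A *ᵥ x) = x := by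
  rw [Matrix.mulVec_mulVec, Matrix.nonsing_inv_mul _ hA.det_pos.ne'.isUnit, Matrix.one_mulVec]

theorem dotProduct_mulVec_comm {n : ℕ} {A : Matrix (Fin n) (Fin n) ℝ} (hA : A.IsSymm)
    (x y : Vec n) : x ⬝ᵥ (A *ᵥ y) = (A *ᵥ x) ⬝ᵥ y := by
  rw [Matrix.dotProduct_mulVec, ← Matrix.mulVec_transpose, hA]

/-- The closed-loop field in matrix form. -/
theorem linDesiredField_eq {n m : ℕ} (M : Matrix (Fin n) (Fin n) ℝ)
    (G : Matrix (Fin n) (Fin m) ℝ) {Mhat : Matrix (Fin n) (Fin n) ℝ} (hMhat : Mhat.PosDef)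
    (Vhat : QuadraticForm ℝ (Vec n)) (Kv : Vec n → Matrix (Fin m) (Fin m) ℝ) (x : Phase n) :
    linDesiredField M G Mhat Vhat Kv x =
      (M⁻¹ *ᵥ x.2, -(Mhat *ᵥ (M⁻¹ *ᵥ (hess Vhat *ᵥ x.1)))
        - G *ᵥ (Kv x.1 *ᵥ (Gᵀ *ᵥ (Mhat⁻¹ *ᵥ x.2)))) := by
  have hp : gradP (hamiltonian (fun _ => Mhat) Vhat) x.1 x.2 = Mhat⁻¹ *ᵥ x.2 := by
    rw [← grad_kinetic Mhat⁻¹ (isSymm_of_posDef hMhat.inv) x.2]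
    funext i
    simp [gradP, grad, hamiltonian]
  have hq : gradQ (hamiltonian (fun _ => Mhat) Vhat) x.1 x.2 = hess Vhat *ᵥ x.1 := by
    rw [← grad_quadratic]
    exact grad_add_const _ _ _
  have hg : gyroForce (fun _ => Mhat) 0 x.1 x.2 = 0 := by
    funext k
    simp [gyroForce]
  refine Prod.ext ?_ ?_
  · simp only [linDesiredField, desiredField, hp, ← Matrix.mulVec_mulVec,
      mulVec_inv_mulVec hMhat]
  · simp only [linDesiredField, desiredField, hp, hq, hg, ← Matrix.mulVec_mulVec, add_zero]

theorem linHamField_apply {n m : ℕ} {M : Matrix (Fin n) (Fin n) ℝ} (hM : M.PosDef)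
    (V : QuadraticForm ℝ (Vec n)) (G : Matrix (Fin n) (Fin m) ℝ) (x : Phase n) (u : Vec m) :
    linHamField M V G x u = (M⁻¹ *ᵥ x.2, -(hess V *ᵥ x.1) + G *ᵥ u) := by
  rw [linHamField_eq M (isSymm_of_posDef hM)]
  simp [stateMap, inputMap]

/-! ### The matching condition and its necessity. -/

/-- A feedback exists when the two forces differ by an element of the range of `G`. -/
theorem transformsTo_of_range {n m : ℕ} {M : Matrix (Fin n) (Fin n) ℝ} (hM : M.PosDef)
    {V : QuadraticForm ℝ (Vec n)} {G : Matrix (Fin n) (Fin m) ℝ}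
    {Mhat : Matrix (Fin n) (Fin n) ℝ} (hMhat : Mhat.PosDef) {Vhat : QuadraticForm ℝ (Vec n)}
    (hVhat : Vhat.PosDef) {K : Matrix (Fin m) (Fin m) ℝ} (hK : K.PosDef)
    (F : Matrix (Fin m) (Fin n) ℝ) (hF : hess V - Mhat * M⁻¹ * hess Vhat = G * F) :
    TransformsTo M V G Mhat Vhat (fun _ => K) where
  posDef_Mhat := hMhat
  posDef_Vhat := hVhat
  smooth_Kv _ _ := contDiff_const
  posDef_Kv _ := hK
  exists_feedback := by
    let L : Phase n →ₗ[ℝ] Vec m := F.mulVecLin ∘ₗ LinearMap.fst ℝ (Vec n) (Vec n)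
      - (K * Gᵀ * Mhat⁻¹).mulVecLin ∘ₗ LinearMap.snd ℝ (Vec n) (Vec n)
    refine ⟨L, L.toContinuousLinearMap.contDiff, fun x => ?_⟩
    have h : hess V *ᵥ x.1 - Mhat *ᵥ (M⁻¹ *ᵥ (hess Vhat *ᵥ x.1)) = G *ᵥ (F *ᵥ x.1) := by
      rw [Matrix.mulVec_mulVec _ G F, ← hF]
      simp [Matrix.sub_mulVec, Matrix.mulVec_mulVec, Matrix.mul_assoc]
    rw [linHamField_apply hM, linDesiredField_eq M G hMhat]
    refine Prod.ext rfl ?_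
    simp only [L, LinearMap.sub_apply, LinearMap.comp_apply, LinearMap.fst_apply,
      LinearMap.snd_apply, Matrix.mulVecLin_apply, Matrix.mulVec_sub, ← h,
      ← Matrix.mulVec_mulVec]
    abel

/-- On vectors annihilated by `Gᵀ`, the two stiffness operators agree. -/
theorem TransformsTo.hess_mulVec {n m : ℕ} {M : Matrix (Fin n) (Fin n) ℝ} (hM : M.PosDef)
    {V : QuadraticForm ℝ (Vec n)} {G : Matrix (Fin n) (Fin m) ℝ}
    {Mhat : Matrix (Fin n) (Fin n) ℝ} {Vhat : QuadraticForm ℝ (Vec n)}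
    {Kv : Vec n → Matrix (Fin m) (Fin m) ℝ} (h : TransformsTo M V G Mhat Vhat Kv)
    {z : Vec n} (hz : Gᵀ *ᵥ z = 0) :
    hess V *ᵥ z = hess Vhat *ᵥ (M⁻¹ *ᵥ (Mhat *ᵥ z)) := by
  obtain ⟨u, -, hu⟩ := h.exists_feedback
  have hG : ∀ w, z ⬝ᵥ (G *ᵥ w) = 0 := fun w => by
    rw [Matrix.dotProduct_mulVec, ← Matrix.mulVec_transpose, hz, zero_dotProduct]
  refine dotProduct_eq _ _ fun q => ?_
  -- At p = 0 the damping vanishes, and pairing with z removes the input, so only the two stiffness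
  -- forces remain.
  have h2 := congrArg (fun y => z ⬝ᵥ y.2) (hu (q, 0))
  simp only [linHamField_apply hM, linDesiredField_eq M G h.posDef_Mhat, dotProduct_add,
    dotProduct_neg, hG, Matrix.mulVec_zero, add_zero, sub_zero, neg_inj] at h2
  rw [← dotProduct_mulVec_comm (hess_isSymm V), h2,
    dotProduct_mulVec_comm (isSymm_of_posDef h.posDef_Mhat),
    dotProduct_mulVec_comm (isSymm_of_posDef hM.inv), dotProduct_mulVec_comm (hess_isSymm Vhat)]

/-- No generalized eigenvector of the pencil `S - e M` with `e ∈ Λ` is annihilated by `Gᵀ`. -/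
def NoHiddenMode {n m : ℕ} (M S : Matrix (Fin n) (Fin n) ℝ) (G : Matrix (Fin n) (Fin m) ℝ)
    (Λ : Set ℝ) : Prop :=
  ∀ e ∈ Λ, ∀ x : Vec n, S *ᵥ x = e • (M *ᵥ x) → Gᵀ *ᵥ x = 0 → x = 0

/-- A hidden mode of a transformable system has positive squared frequency. -/
theorem TransformsTo.noHiddenMode {n m : ℕ} {M : Matrix (Fin n) (Fin n) ℝ} (hM : M.PosDef)
    {V : QuadraticForm ℝ (Vec n)} {G : Matrix (Fin n) (Fin m) ℝ}
    {Mhat : Matrix (Fin n) (Fin n) ℝ} {Vhat : QuadraticForm ℝ (Vec n)}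
    {Kv : Vec n → Matrix (Fin m) (Fin m) ℝ} (h : TransformsTo M V G Mhat Vhat Kv) :
    NoHiddenMode M (hess V) G (Set.Iic 0) := by
  intro e he x hx hGx
  by_contra hx0
  have hS := hess_posDef h.posDef_Vhat
  have h1 : e • (M *ᵥ x) = hess Vhat *ᵥ (M⁻¹ *ᵥ (Mhat *ᵥ x)) := by
    rw [← hx, h.hess_mulVec hM hGx]
  -- Pairing with Ŝ⁻¹ M x yields e (Mx)ᵀ Ŝ⁻¹ (Mx) = xᵀ M̂ x, which fixes the sign of e.
  have h2 := congrArg (fun y => ((hess Vhat)⁻¹ *ᵥ (M *ᵥ x)) ⬝ᵥ y) h1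
  simp only [dotProduct_smul, smul_eq_mul] at h2
  rw [dotProduct_mulVec_comm (hess_isSymm Vhat), mulVec_inv_mulVec hS,
    dotProduct_mulVec_comm (isSymm_of_posDef hM.inv), inv_mulVec_mulVec hM] at h2
  have h3 := dotProduct_pos_of_posDef h.posDef_Mhat hx0
  have hMx : M *ᵥ x ≠ 0 := fun h0 => hx0 (by rw [← inv_mulVec_mulVec hM x, h0, Matrix.mulVec_zero])
  have h4 := dotProduct_pos_of_posDef hS.inv hMx
  rw [dotProduct_comm] at h4
  have : e * ((hess Vhat)⁻¹ *ᵥ M *ᵥ x ⬝ᵥ M *ᵥ x) ≤ 0 :=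
    mul_nonpos_of_nonpos_of_nonneg he h4.le
  linarith

/-! ### Simultaneous diagonalization and partial fractions. -/

theorem exists_orthogonal_diagonalization {n : ℕ} {S : Matrix (Fin n) (Fin n) ℝ}
    (hS : S.IsSymm) : ∃ (O : Matrix (Fin n) (Fin n) ℝ) (a : Fin n → ℝ),
      Oᵀ * O = 1 ∧ Oᵀ * S * O = Matrix.diagonal a := by
  have hH : S.IsHermitian := by simpa [Matrix.IsHermitian] using hS.eq
  have h := hH.conjStarAlgAut_star_eigenvectorUnitary
  refine ⟨hH.eigenvectorUnitary, hH.eigenvalues, ?_, ?_⟩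
  · have := Unitary.coe_star_mul_self hH.eigenvectorUnitary
    simpa [Matrix.star_eq_conjTranspose] using this
  · rw [Unitary.conjStarAlgAut_apply] at h
    simpa [Matrix.star_eq_conjTranspose, Function.comp_def] using h

/-- Simultaneous diagonalization of a positive definite and a symmetric matrix. -/
theorem exists_modal_matrix {n : ℕ} {M S : Matrix (Fin n) (Fin n) ℝ} (hM : M.PosDef)
    (hS : S.IsSymm) : ∃ (T : Matrix (Fin n) (Fin n) ℝ) (a : Fin n → ℝ),
      Tᵀ * M * T = 1 ∧ S * T = M * T * Matrix.diagonal a := by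
  obtain ⟨U, μ, hU, hUM⟩ := exists_orthogonal_diagonalization (isSymm_of_posDef hM)
  have hμ : ∀ i, 0 < μ i := by
    have : (Matrix.diagonal μ).PosDef := by
      rw [← hUM]
      refine posDef_of_dotProduct ?_ fun x hx => ?_
      · simp [Matrix.IsSymm, Matrix.mul_assoc, (isSymm_of_posDef hM).eq]
      · have hx' : U *ᵥ x ≠ 0 := fun h0 => hx (by
          rw [← Matrix.one_mulVec x, ← hU, ← Matrix.mulVec_mulVec, h0, Matrix.mulVec_zero])
        have := dotProduct_pos_of_posDef hM hx'
        rwa [← Matrix.mulVec_mulVec, ← Matrix.mulVec_mulVec, Matrix.dotProduct_mulVec,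
          Matrix.vecMul_transpose]
    exact Matrix.posDef_diagonal_iff.1 this
  let D := Matrix.diagonal fun i => (√(μ i))⁻¹
  let R := U * D
  have hR : Rᵀ * M * R = 1 := by
    have : Rᵀ * M * R = D * (Uᵀ * M * U) * D := by
      simp [R, D, Matrix.mul_assoc]
    rw [this, hUM]
    simp only [D, Matrix.diagonal_mul_diagonal, ← Matrix.diagonal_one]
    congr 1
    funext i
    have h1 := Real.sqrt_pos.2 (hμ i)
    field_simp
    rw [Real.sq_sqrt (hμ i).le]
  obtain ⟨O, a, hO, hOS⟩ := exists_orthogonal_diagonalization (S := Rᵀ * S * R)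
    (by simp [Matrix.IsSymm, Matrix.mul_assoc, hS.eq])
  have h1 : (R * O)ᵀ * M * (R * O) = 1 := by
    have : (R * O)ᵀ * M * (R * O) = Oᵀ * (Rᵀ * M * R) * O := by simp [Matrix.mul_assoc]
    rw [this, hR, Matrix.mul_one, hO]
  refine ⟨R * O, a, h1, ?_⟩
  have h2 : M * (R * O) * (R * O)ᵀ = 1 := by
    rw [Matrix.mul_assoc] at h1
    exact mul_eq_one_comm.1 h1
  have h3 : (R * O)ᵀ * (S * (R * O)) = Matrix.diagonal a := by
    rw [← hOS]
    simp [Matrix.mul_assoc]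
  rw [← h3, ← Matrix.mul_assoc (M * (R * O)), h2, Matrix.one_mul]

/-- Partial fractions with prescribed poles interpolate arbitrary data. -/
theorem exists_partialFraction_eq (E P : Finset ℝ) (hEP : Disjoint E P) (hc : E.card ≤ P.card)
    (f : ℝ → ℝ) : ∃ w : ℝ → ℝ, ∀ a ∈ E, ∑ s ∈ P, w s * (s - a)⁻¹ = f a := by
  -- The degree of g is below |E| ≤ |P|, so g is its own interpolant on P, and the barycentric
  -- formula is the partial fraction expansion of g divided by the nodal polynomial of P.
  let g := Lagrange.interpolate E id fun a => f a * (Lagrange.nodal P id).eval a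
  have hg : g = Lagrange.interpolate P id fun s => g.eval s :=
    Lagrange.eq_interpolate (Function.injective_id.injOn)
      ((Lagrange.degree_interpolate_lt _ Function.injective_id.injOn).trans_le
        (by exact_mod_cast hc))
  refine ⟨fun s => -(Lagrange.nodalWeight P id s * g.eval s), fun a ha => ?_⟩
  have haP : ∀ s ∈ P, a ≠ id s := fun s hs h =>
    Finset.disjoint_left.1 hEP ha (by rw [h]; exact hs)
  have h1 : g.eval a = f a * (Lagrange.nodal P id).eval a :=
    Lagrange.eval_interpolate_at_node _ Function.injective_id.injOn ha
  have h2 := Lagrange.eval_interpolate_not_at_node (s := P) (v := id) (fun s => g.eval s) haP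
  rw [← hg, h1] at h2
  have h3 : (Lagrange.nodal P id).eval a ≠ 0 := by
    rw [Lagrange.eval_nodal]
    exact Finset.prod_ne_zero_iff.2 fun s hs => sub_ne_zero.2 (haP s hs)
  have h4 : f a = ∑ i ∈ P, Lagrange.nodalWeight P id i * (a - id i)⁻¹ * g.eval i :=
    mul_right_cancel₀ h3 (by rw [h2, mul_comm])
  rw [h4]
  refine Finset.sum_congr rfl fun s _ => ?_
  rw [← neg_sub a s, inv_neg, id]
  ring

/-! ### Solving the matching condition in modal coordinates. -/

section Modal

variable {n m : ℕ} {M S T : Matrix (Fin n) (Fin n) ℝ} {a : Fin n → ℝ}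
  {G : Matrix (Fin n) (Fin m) ℝ} {Λ : Set ℝ}

theorem modal_mul_inv (hT : Tᵀ * M * T = 1) : T * (Tᵀ * M) = 1 := mul_eq_one_comm.1 hT

theorem modal_inv (hT : Tᵀ * M * T = 1) : M⁻¹ = T * Tᵀ :=
  Matrix.inv_eq_left_inv (by rw [Matrix.mul_assoc]; exact modal_mul_inv hT)

/-- Cutting y down to the indices with `a i = e` gives the modal coordinates of a pencil eigenvector
at e; if Gᵀ kills it, it would be a hidden mode. -/
theorem NoHiddenMode.modal_eq_zero (h : NoHiddenMode M S G Λ) (hT : Tᵀ * M * T = 1)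
    (hST : S * T = M * T * Matrix.diagonal a) {y : Vec n} {e : ℝ} (he : e ∈ Λ)
    (hy : (Gᵀ * T) *ᵥ (fun i => if a i = e then y i else 0) = 0) (i : Fin n) (hi : a i = e) :
    y i = 0 := by
  set z : Vec n := fun i => if a i = e then y i else 0 with hz
  have hd : Matrix.diagonal a *ᵥ z = e • z := by
    funext j
    rw [Matrix.mulVec_diagonal]
    by_cases hj : a j = e <;> simp [hz, hj]
  have h0 : T *ᵥ z = 0 := by
    refine h e he _ ?_ ?_
    · rw [Matrix.mulVec_mulVec, hST, ← Matrix.mulVec_mulVec, hd, Matrix.mulVec_smul,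
        Matrix.mulVec_mulVec]
    · rw [Matrix.mulVec_mulVec, hy]
  have h1 : z = 0 := by
    rw [← Matrix.one_mulVec z, ← hT, ← Matrix.mulVec_mulVec, h0, Matrix.mulVec_zero]
  simpa [hz, hi] using congrFun h1 i

/-- A sum of weighted squares of resolvents of the input matrix, plus a diagonal term. -/
def resolventGramian (a : Fin n → ℝ) (B : Matrix (Fin n) (Fin m) ℝ) (P : Finset ℝ)
    (w : ℝ → ℝ) (c : Fin n → ℝ) : Matrix (Fin n) (Fin n) ℝ :=
  ∑ s ∈ P, w s • ((Matrix.diagonal (fun i => (s - a i)⁻¹) * B) *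
    (Matrix.diagonal (fun i => (s - a i)⁻¹) * B)ᵀ) + Matrix.diagonal c

theorem dotProduct_resolventGramian (B : Matrix (Fin n) (Fin m) ℝ) (P : Finset ℝ)
    (w : ℝ → ℝ) (c : Fin n → ℝ) (y : Vec n) :
    y ⬝ᵥ (resolventGramian a B P w c *ᵥ y) =
      ∑ s ∈ P, w s * ((Bᵀ *ᵥ fun i => (s - a i)⁻¹ * y i) ⬝ᵥ
        (Bᵀ *ᵥ fun i => (s - a i)⁻¹ * y i)) + ∑ i, c i * y i ^ 2 := by
  have h1 : ∀ s, (Matrix.diagonal (fun i => (s - a i)⁻¹) * B)ᵀ *ᵥ y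
      = Bᵀ *ᵥ fun i => (s - a i)⁻¹ * y i := by
    intro s
    rw [Matrix.transpose_mul, Matrix.diagonal_transpose, ← Matrix.mulVec_mulVec]
    congr 1
    funext i
    rw [Matrix.mulVec_diagonal]
  rw [resolventGramian, Matrix.add_mulVec, dotProduct_add, Matrix.sum_mulVec, dotProduct_sum]
  congr 1
  · refine Finset.sum_congr rfl fun s _ => ?_
    rw [Matrix.smul_mulVec, dotProduct_smul, smul_eq_mul, ← Matrix.mulVec_mulVec,
      Matrix.dotProduct_mulVec, ← Matrix.mulVec_transpose, h1]
  · simp only [dotProduct, Matrix.mulVec_diagonal]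
    exact Finset.sum_congr rfl fun i _ => by ring

/-- A null vector y is killed by every Bᵀ R_s. Combining these equations by partial fractions shows
that Bᵀ kills each eigencomponent of y; those with `a i ≤ 0` vanish for lack of hidden modes, and
the diagonal term disposes of the others. -/
theorem resolventGramian_posDef (h : NoHiddenMode M S G (Set.Iic 0)) (hT : Tᵀ * M * T = 1)
    (hST : S * T = M * T * Matrix.diagonal a) {P : Finset ℝ}
    (hP : Disjoint (Finset.univ.image a) P) (hc : n ≤ P.card) {w : ℝ → ℝ}
    (hw : ∀ s ∈ P, 0 < w s) {c : Fin n → ℝ} (hc0 : ∀ i, 0 ≤ c i)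
    (hcpos : ∀ i, 0 < a i → 0 < c i) :
    (resolventGramian a (Tᵀ * G) P w c).PosDef := by
  have hsq : ∀ v : Vec m, 0 ≤ v ⬝ᵥ v := fun v => Finset.sum_nonneg fun i _ => mul_self_nonneg _
  refine posDef_of_dotProduct ?_ fun y hy => ?_
  · simp [resolventGramian, Matrix.IsSymm, Matrix.transpose_sum, Matrix.mul_assoc]
  rw [dotProduct_resolventGramian]
  have hA : ∀ s ∈ P, 0 ≤ w s * (((Tᵀ * G)ᵀ *ᵥ fun i => (s - a i)⁻¹ * y i) ⬝ᵥ
      ((Tᵀ * G)ᵀ *ᵥ fun i => (s - a i)⁻¹ * y i)) := fun s hs =>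
    mul_nonneg (hw s hs).le (hsq _)
  have hB : ∀ i ∈ Finset.univ, 0 ≤ c i * y i ^ 2 := fun i _ => mul_nonneg (hc0 i) (sq_nonneg _)
  refine (add_nonneg (Finset.sum_nonneg hA) (Finset.sum_nonneg hB)).lt_of_ne fun h0 => hy ?_
  have h1 := (add_eq_zero_iff_of_nonneg (Finset.sum_nonneg hA) (Finset.sum_nonneg hB)).1 h0.symm
  have hres : ∀ s ∈ P, (Gᵀ * T) *ᵥ (fun i => (s - a i)⁻¹ * y i) = 0 := by
    intro s hs
    have := (Finset.sum_eq_zero_iff_of_nonneg hA).1 h1.1 s hs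
    rw [mul_eq_zero, dotProduct_self_eq_zero] at this
    simpa using this.resolve_left (hw s hs).ne'
  have hdiag : ∀ i, c i * y i ^ 2 = 0 := fun i =>
    (Finset.sum_eq_zero_iff_of_nonneg hB).1 h1.2 i (Finset.mem_univ i)
  funext i
  rcases le_or_gt (a i) 0 with hi | hi
  -- Weights for which ∑ f(s) / (s - ·) is the indicator of the eigenvalue `a i` on the spectrum; n
  -- poles suffice because there are at most n distinct eigenvalues.
  · obtain ⟨f, hf⟩ := exists_partialFraction_eq _ P hP
      ((Finset.card_image_le.trans (by simp)).trans hc) (fun x => if x = a i then 1 else 0)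
    refine h.modal_eq_zero hT hST (e := a i) hi ?_ i rfl
    have : (fun j => if a j = a i then y j else 0)
        = ∑ s ∈ P, f s • fun j => (s - a j)⁻¹ * y j := by
      funext j
      have := hf (a j) (Finset.mem_image_of_mem _ (Finset.mem_univ j))
      simp only [Finset.sum_apply, Pi.smul_apply, smul_eq_mul, ← mul_assoc]
      rw [← Finset.sum_mul, this]
      simp
    rw [this, Matrix.mulVec_sum]
    refine Finset.sum_eq_zero fun s hs => ?_
    rw [Matrix.mulVec_smul, hres s hs, smul_zero]
  · have := hdiag i
    rw [mul_eq_zero] at this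
    exact pow_eq_zero_iff (two_ne_zero) |>.1 (this.resolve_left (hcpos i hi).ne')

/-- The identity D (s - D)⁻¹ = s (s - D)⁻¹ - 1 turns the weights 1 into s and leaves a remainder of
the form B W, which feedback can supply. -/
theorem diagonal_mul_resolventGramian (B : Matrix (Fin n) (Fin m) ℝ) {P : Finset ℝ}
    (hP : Disjoint (Finset.univ.image a) P) (c : Fin n → ℝ) :
    Matrix.diagonal a * resolventGramian a B P 1 c =
      resolventGramian a B P id (fun i => a i * c i) -
        B * ∑ s ∈ P, (Matrix.diagonal (fun i => (s - a i)⁻¹) * B)ᵀ := by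
  have key : ∀ s ∈ P, Matrix.diagonal a * (Matrix.diagonal (fun i => (s - a i)⁻¹) * B)
      = s • (Matrix.diagonal (fun i => (s - a i)⁻¹) * B) - B := by
    intro s hs
    ext i j
    have hs' : s - a i ≠ 0 := sub_ne_zero.2 fun h => Finset.disjoint_left.1 hP
      (Finset.mem_image_of_mem a (Finset.mem_univ i)) (h ▸ hs)
    simp only [Matrix.diagonal_mul, Matrix.sub_apply, Matrix.smul_apply, smul_eq_mul]
    field_simp
    ring
  simp only [resolventGramian, Matrix.mul_add, Matrix.diagonal_mul_diagonal, Matrix.mul_sum,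
    Pi.one_apply, one_smul, id]
  rw [add_sub_right_comm, ← Finset.sum_sub_distrib]
  congr 1
  refine Finset.sum_congr rfl fun s hs => ?_
  rw [← Matrix.mul_assoc (Matrix.diagonal a), key s hs, Matrix.sub_mul, Matrix.smul_mul]

theorem posDef_conj {A L : Matrix (Fin n) (Fin n) ℝ} (hA : A.PosDef) (hL : T * L = 1) :
    (Lᵀ * A * L).PosDef := by
  refine posDef_of_dotProduct ?_ fun x hx => ?_
  · simp [Matrix.IsSymm, Matrix.mul_assoc, (isSymm_of_posDef hA).eq]
  · have hx' : L *ᵥ x ≠ 0 := fun h0 => hx (by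
      rw [← Matrix.one_mulVec x, ← hL, ← Matrix.mulVec_mulVec, h0, Matrix.mulVec_zero])
    have := dotProduct_pos_of_posDef hA hx'
    rwa [← Matrix.mulVec_mulVec, ← Matrix.mulVec_mulVec, Matrix.dotProduct_mulVec,
      Matrix.vecMul_transpose]

end Modal

/-- With L = T⁻¹, the choice M̂ = Lᵀ X L, Ŝ = Lᵀ Y⁻¹ L gives M̂ M⁻¹ Ŝ = Lᵀ X Y⁻¹ L, which differs
from S = Lᵀ D L by Lᵀ B W Y⁻¹ L = G W Y⁻¹ L. -/
theorem exists_transformsTo {n m : ℕ} {M : Matrix (Fin n) (Fin n) ℝ} (hM : M.PosDef)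
    {V : QuadraticForm ℝ (Vec n)} {G : Matrix (Fin n) (Fin m) ℝ}
    (h : NoHiddenMode M (hess V) G (Set.Iic 0)) :
    ∃ Mhat Vhat, ∃ K : Matrix (Fin m) (Fin m) ℝ, TransformsTo M V G Mhat Vhat (fun _ => K) := by
  obtain ⟨T, a, hT, hST⟩ := exists_modal_matrix hM (hess_isSymm V)
  obtain ⟨P, hPsub, hPcard⟩ := ((Set.Ioi_infinite (0 : ℝ)).sdiff
    (Finset.univ.image a).finite_toSet).exists_subset_card_eq n
  have hP : Disjoint (Finset.univ.image a) P :=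
    Finset.disjoint_right.2 fun s hs => (hPsub hs).2
  have hpos : ∀ s ∈ P, 0 < s := fun s hs => (hPsub hs).1
  let B := Tᵀ * G
  -- The positive part of a keeps both c and a c nonnegative, and makes both positive exactly where
  -- a is positive.
  let c : Fin n → ℝ := fun i => max (a i) 0
  let Y := resolventGramian a B P 1 c
  let X := resolventGramian a B P id fun i => a i * c i
  let W := ∑ s ∈ P, (Matrix.diagonal (fun i => (s - a i)⁻¹) * B)ᵀ
  have hac : ∀ i, 0 ≤ a i * c i := fun i => by
    rcases le_total (a i) 0 with hi | hi
    · simp [c, hi]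
    · simpa [c, hi] using mul_self_nonneg (a i)
  have hY : Y.PosDef := resolventGramian_posDef h hT hST hP hPcard.ge (fun _ _ => one_pos)
    (fun i => le_max_right _ _) fun i hi => lt_max_of_lt_left hi
  have hX : X.PosDef := resolventGramian_posDef h hT hST hP hPcard.ge hpos hac
    fun i hi => mul_pos hi (lt_max_of_lt_left hi)
  have hXY : Matrix.diagonal a * Y = X - B * W := diagonal_mul_resolventGramian B hP c
  let L := Tᵀ * M
  have hTL : T * L = 1 := modal_mul_inv hT
  have hLT : L * T = 1 := hT
  have hLt : Lᵀ = M * T := by simp [L, (isSymm_of_posDef hM).eq]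
  have hTLt : Tᵀ * Lᵀ = 1 := by rw [← Matrix.transpose_mul, hLT, Matrix.transpose_one]
  obtain ⟨Vhat, hVpos, hVhess⟩ := exists_quadraticForm_hess_eq (posDef_conj hY.inv hTL)
  refine ⟨Lᵀ * X * L, Vhat, 1, transformsTo_of_range hM (posDef_conj hX hTL) hVpos
    Matrix.PosDef.one (-(W * Y⁻¹ * L)) ?_⟩
  have hYY : Y * Y⁻¹ = 1 := Matrix.mul_nonsing_inv _ hY.det_pos.ne'.isUnit
  have h1 : hess V = Lᵀ * Matrix.diagonal a * L := by
    rw [hLt, ← hST, Matrix.mul_assoc, hTL, Matrix.mul_one]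
  have h2 : Lᵀ * X * L * M⁻¹ * (Lᵀ * Y⁻¹ * L) = Lᵀ * X * Y⁻¹ * L := by
    rw [modal_inv hT]
    calc _ = Lᵀ * X * (L * T) * (Tᵀ * Lᵀ) * Y⁻¹ * L := by simp only [Matrix.mul_assoc]
      _ = _ := by rw [hLT, hTLt, Matrix.mul_one, Matrix.mul_one]
  have h3 : Lᵀ * B = G := by
    have : Lᵀ * Tᵀ = 1 := by rw [← Matrix.transpose_mul, hTL, Matrix.transpose_one]
    rw [← Matrix.mul_assoc, this, Matrix.one_mul]
  have h4 : Matrix.diagonal a = X * Y⁻¹ - B * W * Y⁻¹ := by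
    rw [← Matrix.sub_mul, ← hXY, Matrix.mul_assoc, hYY, Matrix.mul_one]
  rw [hVhess, h2, h1, h4, Matrix.mul_sub, Matrix.sub_mul]
  simp only [← Matrix.mul_assoc, h3, Matrix.mul_neg]
  abel

/-! ### Covectors, polynomials in the state map, and the uncontrollable quotient. -/

section Polynomials

open Polynomial

theorem aeval_intertwine {X Y : Type*} [AddCommGroup X] [Module ℝ X] [AddCommGroup Y] [Module ℝ Y]
    {f : Module.End ℝ X} {h : Module.End ℝ Y} {g : X →ₗ[ℝ] Y} (hg : ∀ x, g (f x) = h (g x))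
    (p : ℝ[X]) (x : X) : g (aeval f p x) = aeval h p (g x) := by
  have hk : ∀ (k : ℕ) x, g ((f ^ k) x) = (h ^ k) (g x) := by
    intro k
    induction k with
    | zero => simp
    | succ k ih => intro x; rw [pow_succ, pow_succ, Module.End.mul_apply, ih, hg]; rfl
  simp [aeval_eq_sum_range, LinearMap.sum_apply, hk]

variable {n m : ℕ} {M T : Matrix (Fin n) (Fin n) ℝ} {V : QuadraticForm ℝ (Vec n)} {a : Fin n → ℝ}
  {G : Matrix (Fin n) (Fin m) ℝ} {Λ : Set ℝ}

/-- The operator `M⁻¹ S` whose eigenvalues are the squared frequencies. -/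
def freqOp (M S : Matrix (Fin n) (Fin n) ℝ) : Module.End ℝ (Vec n) := (M⁻¹ * S).mulVecLin

/-- The covector `(q, p) ↦ αᵀ M q + βᵀ p` on phase space. -/
def phaseCovector (M : Matrix (Fin n) (Fin n) ℝ) (α β : Vec n) : Phase n →ₗ[ℝ] ℝ where
  toFun x := (M *ᵥ α) ⬝ᵥ x.1 + β ⬝ᵥ x.2
  map_add' x y := by simp only [Prod.fst_add, Prod.snd_add, dotProduct_add]; ring
  map_smul' c x := by simp [mul_add]

theorem phaseCovector_apply (α β : Vec n) (x : Phase n) :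
    phaseCovector M α β x = (M *ᵥ α) ⬝ᵥ x.1 + β ⬝ᵥ x.2 := rfl

theorem exists_phaseCovector_eq (hM : M.PosDef) (φ : Phase n →ₗ[ℝ] ℝ) :
    ∃ α β, φ = phaseCovector M α β := by
  have h : ∀ f : Vec n →ₗ[ℝ] ℝ, ∃ v : Vec n, ∀ x, f x = v ⬝ᵥ x := fun f =>
    ⟨(dotProductEquiv ℝ (Fin n)).symm f, fun x => by
      have := (dotProductEquiv ℝ (Fin n)).apply_symm_apply f
      exact (congrArg (fun g => g x) this).symm⟩
  obtain ⟨v, hv⟩ := h (φ ∘ₗ LinearMap.inl ℝ _ _)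
  obtain ⟨β, hβ⟩ := h (φ ∘ₗ LinearMap.inr ℝ _ _)
  refine ⟨M⁻¹ *ᵥ v, β, LinearMap.ext fun x => ?_⟩
  rw [phaseCovector_apply, mulVec_inv_mulVec hM, ← hv, ← hβ]
  simp [← map_add]

/-- Weighting α by M makes the adjoint of the state map (α, β) ↦ (-M⁻¹ S β, α), so the adjoint of
-A² acts on both components by `freqOp`. -/
theorem phaseCovector_stateMap (hM : M.PosDef) (α β : Vec n) (x : Phase n) :
    phaseCovector M α β (stateMap M V x) =
      phaseCovector M (-(freqOp M (hess V) β)) α x := by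
  have h1 : (M *ᵥ α) ⬝ᵥ (M⁻¹ *ᵥ x.2) = α ⬝ᵥ x.2 := by
    rw [dotProduct_mulVec_comm (isSymm_of_posDef hM.inv), inv_mulVec_mulVec hM]
  have h2 : M *ᵥ (-(freqOp M (hess V) β)) = -(hess V *ᵥ β) := by
    rw [Matrix.mulVec_neg, freqOp, Matrix.mulVecLin_apply, ← Matrix.mulVec_mulVec,
      mulVec_inv_mulVec hM]
  have h3 : stateMap M V x = (M⁻¹ *ᵥ x.2, -(hess V *ᵥ x.1)) := rfl
  rw [phaseCovector_apply, phaseCovector_apply, h2, h3, h1, dotProduct_neg, neg_dotProduct,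
    dotProduct_mulVec_comm (hess_isSymm V)]
  ring

theorem phaseCovector_inputMap (α β : Vec n) (u : Vec m) :
    phaseCovector M α β (inputMap G u) = (Gᵀ *ᵥ β) ⬝ᵥ u := by
  simp [phaseCovector_apply, inputMap, Matrix.dotProduct_mulVec, Matrix.mulVec_transpose]

theorem phaseCovector_aeval (hM : M.PosDef) (r : ℝ[X]) (α β : Vec n) (x : Phase n) :
    phaseCovector M α β (aeval (-(stateMap M V * stateMap M V)) r x) =
      phaseCovector M (aeval (freqOp M (hess V)) r α) (aeval (freqOp M (hess V)) r β) x := by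
  have h1 : ∀ α β x, phaseCovector M α β ((-(stateMap M V * stateMap M V)) x) =
      phaseCovector M (freqOp M (hess V) α) (freqOp M (hess V) β) x := by
    intro α β x
    rw [LinearMap.neg_apply, map_neg, Module.End.mul_apply, phaseCovector_stateMap hM,
      phaseCovector_stateMap hM]
    simp only [phaseCovector_apply, Matrix.mulVec_neg, neg_dotProduct]
    ring
  have hk : ∀ (k : ℕ) α β x, phaseCovector M α β (((-(stateMap M V * stateMap M V)) ^ k) x) =
      phaseCovector M ((freqOp M (hess V) ^ k) α) ((freqOp M (hess V) ^ k) β) x := by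
    intro k
    induction k with
    | zero => simp
    | succ k ih =>
      intro α β x
      rw [pow_succ', Module.End.mul_apply, h1, ih, pow_succ, Module.End.mul_apply,
        Module.End.mul_apply]
  simp only [aeval_eq_sum_range, LinearMap.sum_apply, LinearMap.smul_apply, map_sum, map_smul, hk]
  simp only [phaseCovector_apply, Matrix.mulVec_sum, Matrix.mulVec_smul, sum_dotProduct,
    smul_dotProduct, smul_eq_mul, Finset.sum_add_distrib, mul_add]

/-- A covector that annihilates the controllable subspace. -/
theorem phaseCovector_annihilates (hM : M.PosDef) {α β : Vec n}
    (h : ∀ (k : ℕ) u, phaseCovector M α β ((stateMap M V ^ k) (inputMap G u)) = 0) (r : ℝ[X]) :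
    Gᵀ *ᵥ (aeval (freqOp M (hess V)) r α) = 0 ∧ Gᵀ *ᵥ (aeval (freqOp M (hess V)) r β) = 0 := by
  have hp : ∀ (p : ℝ[X]) u, phaseCovector M α β (aeval (stateMap M V) p (inputMap G u)) = 0 := by
    intro p u
    rw [aeval_eq_sum_range, LinearMap.sum_apply, map_sum]
    refine Finset.sum_eq_zero fun k _ => ?_
    rw [LinearMap.smul_apply, map_smul, h, smul_zero]
  have hcomp : aeval (stateMap M V) (r.comp (-(X * X)))
      = aeval (-(stateMap M V * stateMap M V)) r := by
    rw [aeval_comp]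
    simp
  constructor
  · refine dotProduct_eq_zero _ fun u => ?_
    -- Inputs enter through β only; the extra factor X moves α into that slot.
    have := hp (r.comp (-(X * X)) * X) u
    rw [map_mul, hcomp, Module.End.mul_apply, phaseCovector_aeval hM, aeval_X,
      phaseCovector_stateMap hM, phaseCovector_inputMap] at this
    exact this
  · refine dotProduct_eq_zero _ fun u => ?_
    have := hp (r.comp (-(X * X))) u
    rwa [hcomp, phaseCovector_aeval hM, phaseCovector_inputMap] at this

theorem aeval_freqOp_modal (hT : Tᵀ * M * T = 1)
    (hST : hess V * T = M * T * Matrix.diagonal a) (r : ℝ[X]) (z : Vec n) :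
    aeval (freqOp M (hess V)) r z = T *ᵥ fun i => r.eval (a i) * ((Tᵀ * M) *ᵥ z) i := by
  have h0 : M⁻¹ * M = 1 := by
    rw [modal_inv hT, Matrix.mul_assoc, modal_mul_inv hT]
  have h1 : ∀ y, T.mulVecLin ((Matrix.diagonal a).mulVecLin y)
      = freqOp M (hess V) (T.mulVecLin y) := by
    intro y
    simp only [freqOp, Matrix.mulVecLin_apply, Matrix.mulVec_mulVec]
    rw [Matrix.mul_assoc, hST, ← Matrix.mul_assoc, ← Matrix.mul_assoc, h0, Matrix.one_mul]
  have hk : ∀ (k : ℕ) y i, (((Matrix.diagonal a).mulVecLin ^ k) y) i = a i ^ k * y i := by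
    intro k
    induction k with
    | zero => simp
    | succ k ih =>
      intro y i
      rw [pow_succ, Module.End.mul_apply, ih, Matrix.mulVecLin_apply, Matrix.mulVec_diagonal]
      ring
  have h2 : ∀ y, aeval (Matrix.diagonal a).mulVecLin r y = fun i => r.eval (a i) * y i := by
    intro y
    funext i
    rw [aeval_eq_sum_range, LinearMap.sum_apply, Finset.sum_apply, eval_eq_sum_range,
      Finset.sum_mul]
    refine Finset.sum_congr rfl fun k _ => ?_
    rw [LinearMap.smul_apply, Pi.smul_apply, hk, smul_eq_mul, mul_assoc]
  have h3 : z = T.mulVecLin ((Tᵀ * M) *ᵥ z) := by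
    rw [Matrix.mulVecLin_apply, Matrix.mulVec_mulVec, modal_mul_inv hT, Matrix.one_mulVec]
  conv_lhs => rw [h3, ← aeval_intertwine h1, h2]
  rfl

/-- The Lagrange polynomial that is 1 at `a i` and 0 at the other eigenvalues is the spectral
projector, so Gᵀ kills the component of z at `a i`. -/
theorem NoHiddenMode.modal_coord_eq_zero (h : NoHiddenMode M (hess V) G Λ)
    (hT : Tᵀ * M * T = 1) (hST : hess V * T = M * T * Matrix.diagonal a) {z : Vec n}
    (hz : ∀ r : ℝ[X], Gᵀ *ᵥ (aeval (freqOp M (hess V)) r z) = 0) (i : Fin n) (hi : a i ∈ Λ) :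
    ((Tᵀ * M) *ᵥ z) i = 0 := by
  refine h.modal_eq_zero hT hST hi ?_ i rfl
  have := hz (Lagrange.interpolate (Finset.univ.image a) id fun x => if x = a i then 1 else 0)
  rw [aeval_freqOp_modal hT hST, Matrix.mulVec_mulVec] at this
  rw [← this]
  congr 1
  funext j
  have h2 := Lagrange.eval_interpolate_at_node (s := Finset.univ.image a) (v := id)
    (fun x => if x = a i then (1 : ℝ) else 0) Function.injective_id.injOn
    (Finset.mem_image_of_mem a (Finset.mem_univ j))
  rw [id] at h2
  rw [h2]
  simp

theorem NoHiddenMode.eq_zero (h : NoHiddenMode M (hess V) G Set.univ) (hM : M.PosDef) {z : Vec n}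
    (hz : ∀ r : ℝ[X], Gᵀ *ᵥ (aeval (freqOp M (hess V)) r z) = 0) : z = 0 := by
  obtain ⟨T, a, hT, hST⟩ := exists_modal_matrix hM (hess_isSymm V)
  have h0 : (Tᵀ * M) *ᵥ z = 0 := funext fun i =>
    h.modal_coord_eq_zero hT hST hz i (Set.mem_univ _)
  rw [← Matrix.one_mulVec z, ← modal_mul_inv hT, ← Matrix.mulVec_mulVec, h0, Matrix.mulVec_zero]

/-- The roots ±i√e are all distinct. Positivity matters: e = 0 would contribute a double root. -/
theorem separable_prod_neg_sq_sub {E : Finset ℝ} (hE : ∀ e ∈ E, 0 < e) :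
    (∏ e ∈ E, (-(X * X) - C e : ℝ[X])).Separable := by
  refine separable_prod' (fun e _ e' _ hne => ?_) fun e he => ?_
  · refine ⟨C (e' - e)⁻¹, -C (e' - e)⁻¹, ?_⟩
    have : C (e' - e)⁻¹ * (C e' - C e) = (1 : ℝ[X]) := by
      rw [← C_sub, ← C_mul, inv_mul_cancel₀ (sub_ne_zero.2 hne.symm), C_1]
    linear_combination this
  -- Bézout coefficients: -(1/e)(-X² - e) + (X/(2e))(-2X) = 1.
  · refine ⟨-C e⁻¹, C (e⁻¹ / 2) * X, ?_⟩
    have h1 : C e⁻¹ * C e = (1 : ℝ[X]) := by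
      rw [← C_mul, inv_mul_cancel₀ (hE e he).ne', C_1]
    have h2 : C (e⁻¹ / 2) * 2 = (C e⁻¹ : ℝ[X]) := by
      rw [← C_ofNat, ← C_mul]
      congr 1
      ring
    have h3 : derivative (-(X * X) - C e : ℝ[X]) = -(2 * X) := by
      simp
      ring
    rw [h3]
    linear_combination h1 - X * X * h2

/-- A squarefree annihilating polynomial makes the complexification semisimple, and every eigenvalue
is a root, so its square is some -e < 0. -/
theorem oscillatory_of_aeval_eq_zero {X' : Type*} [AddCommGroup X'] [Module ℝ X']
    [FiniteDimensional ℝ X'] {A : Module.End ℝ X'} {E : Finset ℝ} (hE : ∀ e ∈ E, 0 < e)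
    (hA : aeval A (∏ e ∈ E, (-(X * X) - C e : ℝ[X])) = 0) : Oscillatory A := by
  set p : ℝ[X] := ∏ e ∈ E, (-(X * X) - C e) with hp
  have h0 : aeval (LinearMap.baseChange ℂ A) (p.map (algebraMap ℝ ℂ)) = 0 := by
    rw [aeval_map_algebraMap]
    have := aeval_algHom_apply (Module.End.baseChangeHom ℝ ℂ X') A p
    rw [hA, map_zero] at this
    exact this
  have hss := Module.End.isSemisimple_of_squarefree_aeval_eq_zero
    ((separable_prod_neg_sq_sub hE).map (f := algebraMap ℝ ℂ)).squarefree h0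
  refine ⟨?_, fun μ hμ => ?_⟩
  · rw [← Module.End.iSup_maxGenEigenspace_eq_top (LinearMap.baseChange ℂ A)]
    exact iSup_congr fun μ =>
      (hss.isFinitelySemisimple.maxGenEigenspace_eq_eigenspace μ).symm
  · obtain ⟨v, hv⟩ := hμ.exists_hasEigenvector
    have h1 := Module.End.aeval_apply_of_hasEigenvector (p := p.map (algebraMap ℝ ℂ)) hv
    rw [h0, LinearMap.zero_apply, eq_comm, smul_eq_zero] at h1
    have h2 := h1.resolve_right hv.2
    rw [hp, Polynomial.map_prod, eval_prod, Finset.prod_eq_zero_iff] at h2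
    obtain ⟨e, he, h3⟩ := h2
    have he0 := hE e he
    have h4 : μ * μ = -(e : ℂ) := by
      simp at h3
      linear_combination -h3
    have hre := congrArg Complex.re h4
    have him := congrArg Complex.im h4
    simp at hre him
    have him0 : μ.im ≠ 0 := fun h => by rw [h] at hre; nlinarith
    refine ⟨?_, fun h => him0 (by rw [h]; rfl)⟩
    have : μ.re * μ.im = 0 := by linarith
    exact (mul_eq_zero.1 this).resolve_right him0

/-- Let r be the product of X - e over the positive eigenvalues. Then r(-A²) maps into the
controllable subspace: a covector annihilating that subspace has no modal components with e ≤ 0, and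
r kills the rest. So r(-X²) annihilates the quotient dynamics. -/
theorem NoHiddenMode.oscillatory (h : NoHiddenMode M (hess V) G (Set.Iic 0)) (hM : M.PosDef) :
    Oscillatory (uncontrollableDynamics (stateMap M V) (inputMap G)) := by
  obtain ⟨T, a, hT, hST⟩ := exists_modal_matrix hM (hess_isSymm V)
  let E := (Finset.univ.image a).filter (0 < ·)
  let r : ℝ[X] := ∏ e ∈ E, (X - C e)
  refine oscillatory_of_aeval_eq_zero (E := E) (fun e he => (Finset.mem_filter.1 he).2) ?_
  have hr : (∏ e ∈ E, (-(X * X) - C e : ℝ[X])) = r.comp (-(X * X)) := by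
    simp [r, Polynomial.prod_comp]
  have hzero : ∀ z : Vec n, (∀ r' : ℝ[X], Gᵀ *ᵥ (aeval (freqOp M (hess V)) r' z) = 0) →
      aeval (freqOp M (hess V)) r z = 0 := by
    intro z hz
    rw [aeval_freqOp_modal hT hST]
    convert Matrix.mulVec_zero T
    rename_i i
    rcases le_or_gt (a i) 0 with hi | hi
    · rw [h.modal_coord_eq_zero hT hST hz i hi, mul_zero]; rfl
    · have : r.eval (a i) = 0 := by
        rw [eval_prod]
        exact Finset.prod_eq_zero (i := a i) (by simp [E, hi]) (by simp)
      rw [this, zero_mul]; rfl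
  have hmem : ∀ x, aeval (stateMap M V) (r.comp (-(X * X))) x
      ∈ controllableSubspace (stateMap M V) (inputMap G) := by
    intro x
    by_contra hx
    obtain ⟨φ, hφx, hφ⟩ := Submodule.exists_le_ker_of_notMem hx
    obtain ⟨α, β, rfl⟩ := exists_phaseCovector_eq hM φ
    have hann := phaseCovector_annihilates (G := G) hM fun k u =>
      hφ (Submodule.mem_iSup_of_mem k ⟨u, rfl⟩)
    apply hφx
    rw [aeval_comp]
    simp only [map_neg, map_mul, aeval_X]
    rw [phaseCovector_aeval hM, hzero α fun r' => (hann r').1, hzero β fun r' => (hann r').2]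
    simp [phaseCovector_apply]
  rw [hr]
  refine LinearMap.ext fun y => ?_
  obtain ⟨x, rfl⟩ := Submodule.mkQ_surjective _ y
  rw [← aeval_intertwine (f := stateMap M V) (g := Submodule.mkQ _) (fun x => rfl), LinearMap.zero_apply,
    Submodule.mkQ_apply, Submodule.Quotient.mk_eq_zero]
  exact hmem x

/-- A hidden mode at e ≤ 0 gives a left eigenvector of A with real eigenvalue √(-e) that kills the
inputs. It descends to the quotient, whose dynamics then has a real eigenvalue. -/
theorem noHiddenMode_of_oscillatory (hM : M.PosDef)
    (h : Oscillatory (uncontrollableDynamics (stateMap M V) (inputMap G))) :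
    NoHiddenMode M (hess V) G (Set.Iic 0) := by
  intro e he x hx hGx
  by_contra hx0
  set μ := √(-e) with hμ
  have hμ2 : μ * μ = -e := Real.mul_self_sqrt (neg_nonneg.2 he)
  have hfx : freqOp M (hess V) x = e • x := by
    rw [freqOp, Matrix.mulVecLin_apply, ← Matrix.mulVec_mulVec, hx, Matrix.mulVec_smul,
      inv_mulVec_mulVec hM]
  let φ := phaseCovector M (μ • x) x
  have hφA : ∀ y, φ (stateMap M V y) = μ * φ y := by
    intro y
    simp only [φ]
    rw [phaseCovector_stateMap hM, hfx]
    simp only [phaseCovector_apply, Matrix.mulVec_neg, Matrix.mulVec_smul, neg_dotProduct,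
      smul_dotProduct, smul_eq_mul]
    linear_combination (-(M *ᵥ x ⬝ᵥ y.1)) * hμ2
  have hφk : ∀ (k : ℕ) y, φ ((stateMap M V ^ k) y) = μ ^ k * φ y := by
    intro k
    induction k with
    | zero => simp
    | succ k ih =>
      intro y
      rw [pow_succ', Module.End.mul_apply, hφA, ih, pow_succ']
      ring
  have hker : controllableSubspace (stateMap M V) (inputMap G) ≤ LinearMap.ker φ := by
    refine iSup_le fun k => ?_
    rintro _ ⟨u, rfl⟩
    rw [LinearMap.mem_ker, LinearMap.comp_apply, hφk]
    simp only [φ]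
    rw [phaseCovector_inputMap, hGx, zero_dotProduct, mul_zero]
  let W := controllableSubspace (stateMap M V) (inputMap G)
  let F : (Phase n ⧸ W) →ₗ[ℝ] (Phase n ⧸ W) :=
    uncontrollableDynamics (stateMap M V) (inputMap G)
  let ψ : (Phase n ⧸ W) →ₗ[ℝ] ℝ := W.liftQ φ hker
  have hψ : ∀ y, ψ (F y) = μ * ψ y := by
    intro y
    obtain ⟨y, rfl⟩ := Submodule.mkQ_surjective _ y
    exact hφA y
  have hψ0 : ψ (W.mkQ (0, x)) ≠ 0 := by
    have : ψ (W.mkQ (0, x)) = φ (0, x) := rfl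
    rw [this]
    simpa [φ, phaseCovector_apply] using hx0
  -- The range of F - μ lies in ker ψ; in finite dimension failure of surjectivity yields an
  -- eigenvector.
  have hnotsurj : ¬ Function.Surjective
      (F - μ • LinearMap.id : (Phase n ⧸ W) →ₗ[ℝ] (Phase n ⧸ W)) := by
    intro hs
    obtain ⟨y, hy⟩ := hs (W.mkQ (0, x))
    apply hψ0
    rw [← hy]
    simp [hψ]
  rw [← LinearMap.injective_iff_surjective] at hnotsurj
  obtain ⟨v, hv, hv0⟩ : ∃ v, F v = μ • v ∧ v ≠ 0 := by
    by_contra! hcon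
    refine hnotsurj ((injective_iff_map_eq_zero _).2 fun v hv => hcon v ?_)
    simpa [sub_eq_zero] using hv
  have hev : Module.End.HasEigenvalue (LinearMap.baseChange ℂ F) (μ : ℂ) := by
    refine Module.End.hasEigenvalue_of_hasEigenvector (x := (1 : ℂ) ⊗ₜ[ℝ] v) ⟨?_, ?_⟩
    · rw [Module.End.mem_eigenspace_iff, LinearMap.baseChange_tmul, hv, TensorProduct.tmul_smul,
        TensorProduct.smul_tmul', TensorProduct.smul_tmul']
      simp
    · intro h0
      exact hv0 (Module.FaithfullyFlat.tensorProduct_mk_injective (A := ℝ) (B := ℂ) _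
        (by simpa using h0))
  obtain ⟨hre, hne⟩ := h.2 _ hev
  rw [Complex.ofReal_re] at hre
  exact hne (by rw [hre, Complex.ofReal_zero])

end Polynomials

/-! ### Controllability as absence of hidden modes. -/

section Controllability

open MeasureTheory

/-- For a hidden mode z, the quantity (zᵀp)² + e (zᵀMq)² is conserved under every input, so steering
0 to (0, z) forces z = 0. The sign of e plays no role. -/
theorem noHiddenMode_of_controllable {n m : ℕ} {M : Matrix (Fin n) (Fin n) ℝ} (hM : M.PosDef)
    {V : QuadraticForm ℝ (Vec n)} {G : Matrix (Fin n) (Fin m) ℝ}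
    (h : Controllable (linHamField M V G)) : NoHiddenMode M (hess V) G Set.univ := by
  intro e _ z hz hGz
  obtain ⟨T, hT, u, x, -, hx, hx0, hx1⟩ := h 0 (0, z)
  have hfz : freqOp M (hess V) z = e • z := by
    rw [freqOp, Matrix.mulVecLin_apply, ← Matrix.mulVec_mulVec, hz, Matrix.mulVec_smul,
      inv_mulVec_mulVec hM]
  let φ := phaseCovector M z 0
  let ψ := phaseCovector M 0 z
  have hφ : ∀ y v, φ (linHamField M V G y v) = ψ y := by
    intro y v
    simp only [φ, ψ]
    rw [linHamField_eq M (isSymm_of_posDef hM), map_add, phaseCovector_stateMap hM,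
      phaseCovector_inputMap, map_zero, neg_zero, Matrix.mulVec_zero, zero_dotProduct, add_zero]
  have hψ : ∀ y v, ψ (linHamField M V G y v) = -(e * φ y) := by
    intro y v
    simp only [φ, ψ]
    rw [linHamField_eq M (isSymm_of_posDef hM), map_add, phaseCovector_stateMap hM,
      phaseCovector_inputMap, hGz, zero_dotProduct, add_zero, hfz]
    simp [phaseCovector_apply, Matrix.mulVec_neg, Matrix.mulVec_smul]
  have hd : ∀ t ∈ Set.Icc 0 T, HasDerivWithinAt (fun t => ψ (x t) ^ 2 + e * φ (x t) ^ 2) 0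
      (Set.Icc 0 T) t := by
    intro t ht
    have h1 := φ.toContinuousLinearMap.hasFDerivAt.comp_hasDerivWithinAt t (hx t ht)
    have h2 := ψ.toContinuousLinearMap.hasFDerivAt.comp_hasDerivWithinAt t (hx t ht)
    have h3 := (h2.pow 2).add ((h1.pow 2).const_mul e)
    refine h3.congr_deriv ?_
    simp only [LinearMap.coe_toContinuousLinearMap', hφ, hψ, Function.comp_apply]
    ring
  have hc := constant_of_derivWithin_zero (fun t ht => (hd t ht).differentiableWithinAt)
    (fun t ht => (hd t (Set.Ico_subset_Icc_self ht)).derivWithin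
      (uniqueDiffOn_Icc hT t (Set.Ico_subset_Icc_self ht))) T (Set.right_mem_Icc.2 hT.le)
  rw [hx0, hx1] at hc
  simpa [φ, ψ, phaseCovector_apply] using hc

variable {X : Type*} [NormedAddCommGroup X] [NormedSpace ℝ X] {m : ℕ}

theorem exp_smul_mul_exp_neg_smul [CompleteSpace X] (A : X →L[ℝ] X) (t : ℝ) :
    NormedSpace.exp (t • A) * NormedSpace.exp (-(t • A)) = 1 := by
  let _ : NormedAlgebra ℚ (X →L[ℝ] X) := NormedAlgebra.restrictScalars ℚ ℝ _
  rw [← NormedSpace.exp_add_of_commute (Commute.neg_right (Commute.refl _)), add_neg_cancel,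
    NormedSpace.exp_zero]

theorem exp_smul_exp_neg_smul [CompleteSpace X] (A : X →L[ℝ] X) (t : ℝ) (x : X) :
    NormedSpace.exp (t • A) (NormedSpace.exp (-(t • A)) x) = x := by
  rw [← mul_apply_eq_comp, exp_smul_mul_exp_neg_smul, one_apply_eq_self]

theorem hasDerivAt_exp_smul_apply [CompleteSpace X] (A : X →L[ℝ] X) (t : ℝ) (x : X) :
    HasDerivAt (fun s : ℝ => NormedSpace.exp (s • A) x) (NormedSpace.exp (t • A) (A x)) t := by
  simpa using (hasDerivAt_exp_smul_const A t).clm_apply (hasDerivAt_const t x)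

theorem continuous_exp_smul [CompleteSpace X] (A : X →L[ℝ] X) :
    Continuous fun s : ℝ => NormedSpace.exp (s • A) :=
  continuous_iff_continuousAt.2 fun t => (hasDerivAt_exp_smul_const A t).continuousAt

/-- The state reached (up to the free motion) by a continuous input on `[0, 1]`. -/
def reachMap [CompleteSpace X] (A : X →L[ℝ] X) (B : Vec m →L[ℝ] X) : C(ℝ, Vec m) →ₗ[ℝ] X where
  toFun u := ∫ s in (0 : ℝ)..1, NormedSpace.exp (s • (-A)) (B (u s))
  map_add' u v := by
    have hc : ∀ w : C(ℝ, Vec m), Continuous fun s : ℝ => NormedSpace.exp (s • (-A)) (B (w s)) :=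
      fun w => (continuous_exp_smul (-A)).clm_apply (B.continuous.comp w.continuous)
    simp only [ContinuousMap.add_apply, map_add]
    exact intervalIntegral.integral_add ((hc u).intervalIntegrable _ _)
      ((hc v).intervalIntegrable _ _)
  map_smul' c u := by
    simp only [ContinuousMap.smul_apply, map_smul, RingHom.id_apply]
    exact intervalIntegral.integral_smul c _

/-- If φ annihilates the range, test it on the input u(s) = Bᵀ exp(-sAᵀ) φ: the integral of |u|²
vanishes, so u = 0 on [0, 1]. Repeated differentiation brings down the powers of A. -/
theorem reachMap_surjective [FiniteDimensional ℝ X] [CompleteSpace X] (A : X →L[ℝ] X)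
    (B : Vec m →L[ℝ] X) (h : ∀ φ : X →ₗ[ℝ] ℝ, (∀ (k : ℕ) u, φ ((A ^ k) (B u)) = 0) → φ = 0) :
    Function.Surjective (reachMap A B) := by
  rw [← LinearMap.range_eq_top]
  by_contra hne
  obtain ⟨φ, hφ0, hφ⟩ := Submodule.exists_le_ker_of_lt_top _ (lt_top_iff_ne_top.2 hne)
  let Φ := φ.toContinuousLinearMap
  have hcont : ∀ v : Vec m, Continuous fun s : ℝ => φ (NormedSpace.exp (s • (-A)) (B v)) :=
    fun v => Φ.continuous.comp ((continuous_exp_smul (-A)).clm_apply continuous_const)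
  let u : C(ℝ, Vec m) :=
    ⟨fun s j => φ (NormedSpace.exp (s • (-A)) (B (Pi.single j 1))),
      continuous_pi fun j => hcont _⟩
  have hval : ∀ s v, φ (NormedSpace.exp (s • (-A)) (B v)) = u s ⬝ᵥ v := by
    intro s v
    have := LinearMap.pi_apply_eq_sum_univ
      (φ ∘ₗ (NormedSpace.exp (s • (-A))).toLinearMap ∘ₗ B.toLinearMap) v
    simp only [LinearMap.comp_apply, ContinuousLinearMap.coe_coe] at this
    rw [this]
    refine Finset.sum_congr rfl fun j _ => ?_
    have hj : (fun k => if j = k then (1 : ℝ) else 0) = Pi.single j 1 := by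
      funext k
      simp [Pi.single_apply, eq_comm]
    rw [smul_eq_mul, mul_comm, hj]
    rfl
  have hzero : ∀ s ∈ Set.Icc (0 : ℝ) 1, u s = 0 := by
    by_contra! hcon
    obtain ⟨s, hs, hus⟩ := hcon
    have hnn : ∀ v : Vec m, 0 ≤ v ⬝ᵥ v := fun v =>
      Finset.sum_nonneg fun i _ => mul_self_nonneg _
    have hc : Continuous fun s => u s ⬝ᵥ u s := u.continuous.dotProduct u.continuous
    have hpos : 0 < ∫ s in (0 : ℝ)..1, u s ⬝ᵥ u s :=
      intervalIntegral.integral_pos one_pos hc.continuousOn (fun s _ => hnn _)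
        ⟨s, hs, (hnn _).lt_of_ne fun h0 => hus (dotProduct_self_eq_zero.1 h0.symm)⟩
    have h1 : Φ (reachMap A B u) = 0 := hφ ⟨u, rfl⟩
    have hcu : Continuous fun s : ℝ => NormedSpace.exp (s • (-A)) (B (u s)) :=
      (continuous_exp_smul (-A)).clm_apply (B.continuous.comp u.continuous)
    have h2 : Φ (reachMap A B u)
        = ∫ s in (0 : ℝ)..1, Φ (NormedSpace.exp (s • (-A)) (B (u s))) :=
      (Φ.intervalIntegral_comp_comm (hcu.intervalIntegrable 0 1)).symm
    rw [h1] at h2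
    have h3 : ∀ s, Φ (NormedSpace.exp (s • (-A)) (B (u s))) = u s ⬝ᵥ u s := fun s => hval s _
    simp only [h3] at h2
    exact hpos.ne h2
  have hk : ∀ (k : ℕ) v, ∀ s ∈ Set.Ioo (0 : ℝ) 1,
      φ (NormedSpace.exp (s • (-A)) ((A ^ k) (B v))) = 0 := by
    intro k v
    induction k with
    | zero =>
      intro s hs
      rw [pow_zero, one_apply_eq_self, hval, hzero s (Set.Ioo_subset_Icc_self hs),
        zero_dotProduct]
    | succ k ih =>
      intro s hs
      have h1 := Φ.hasFDerivAt.comp_hasDerivAt s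
        (hasDerivAt_exp_smul_apply (-A) s ((A ^ k) (B v)))
      have h2 : HasDerivAt (Φ ∘ fun s : ℝ => NormedSpace.exp (s • (-A)) ((A ^ k) (B v))) 0 s := by
        refine (hasDerivAt_const s (0 : ℝ)).congr_of_eventuallyEq ?_
        filter_upwards [Ioo_mem_nhds hs.1 hs.2] with t ht using ih t ht
      have h3 := h1.unique h2
      rw [neg_apply, map_neg, map_neg, neg_eq_zero] at h3
      rw [pow_succ', mul_apply_eq_comp]
      exact h3
  -- Any interior time would do, since the exponential is invertible.
  have hz := h (φ ∘ₗ (NormedSpace.exp ((1 / 2 : ℝ) • (-A))).toLinearMap)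
    fun k v => hk k v _ (by norm_num)
  refine hφ0 (LinearMap.ext fun x => ?_)
  have := congrArg (fun f => f (NormedSpace.exp (-((1 / 2 : ℝ) • (-A))) x)) hz
  simpa only [LinearMap.comp_apply, ContinuousLinearMap.coe_coe, exp_smul_exp_neg_smul,
    LinearMap.zero_apply] using this

/-- A linear control system with no nonzero covector annihilating all `A ^ k B` is
controllable. -/
theorem controllable_of_forall_covector [FiniteDimensional ℝ X] [CompleteSpace X] (A : X →L[ℝ] X)
    (B : Vec m →L[ℝ] X) (h : ∀ φ : X →ₗ[ℝ] ℝ, (∀ (k : ℕ) u, φ ((A ^ k) (B u)) = 0) → φ = 0) :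
    Controllable fun x u => A x + B u := by
  intro x₀ x₁
  obtain ⟨u, hu⟩ := reachMap_surjective A B h (NormedSpace.exp (-((1 : ℝ) • A)) x₁ - x₀)
  have hcu : Continuous fun s : ℝ => NormedSpace.exp (s • (-A)) (B (u s)) :=
    (continuous_exp_smul (-A)).clm_apply (B.continuous.comp u.continuous)
  -- Variation of constants: exp(tA) y(t) is the controlled trajectory.
  let y : ℝ → X := fun t => x₀ + ∫ s in (0 : ℝ)..t, NormedSpace.exp (s • (-A)) (B (u s))
  have hy : ∀ t, HasDerivAt y (NormedSpace.exp (t • (-A)) (B (u t))) t := fun t =>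
    (hcu.integral_hasStrictDerivAt 0 t).hasDerivAt.const_add x₀
  refine ⟨1, one_pos, u, fun t => NormedSpace.exp (t • A) (y t), u.continuous.continuousOn,
    fun t _ => ?_, ?_, ?_⟩
  · have h1 := (hasDerivAt_exp_smul_const' A t).clm_apply (hy t)
    rw [smul_neg, exp_smul_exp_neg_smul] at h1
    exact h1.hasDerivWithinAt
  · simp [y]
  · have : y 1 = NormedSpace.exp (-((1 : ℝ) • A)) x₁ := by
      change x₀ + reachMap A B u = _
      rw [hu]
      abel
    change NormedSpace.exp ((1 : ℝ) • A) (y 1) = x₁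
    rw [this, exp_smul_exp_neg_smul]

theorem NoHiddenMode.controllable {n m : ℕ} {M : Matrix (Fin n) (Fin n) ℝ} (hM : M.PosDef)
    {V : QuadraticForm ℝ (Vec n)} {G : Matrix (Fin n) (Fin m) ℝ}
    (h : NoHiddenMode M (hess V) G Set.univ) : Controllable (linHamField M V G) := by
  have hF : linHamField M V G = fun x u => (stateMap M V).toContinuousLinearMap x
      + (inputMap G).toContinuousLinearMap u := by
    funext x u
    exact linHamField_eq M (isSymm_of_posDef hM) V G x u
  rw [hF]
  refine controllable_of_forall_covector _ _ fun φ hφ => ?_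
  obtain ⟨α, β, rfl⟩ := exists_phaseCovector_eq hM φ
  have hpow : ∀ (k : ℕ) x, ((stateMap M V).toContinuousLinearMap ^ k) x
      = (stateMap M V ^ k) x := by
    intro k
    induction k with
    | zero => simp
    | succ k ih =>
      intro x
      rw [pow_succ, pow_succ, mul_apply_eq_comp, ih]
      rfl
  have hann := phaseCovector_annihilates (V := V) (G := G) hM fun k u => by
    have := hφ k u
    rwa [hpow] at this
  rw [h.eq_zero hM fun r => (hann r).1, h.eq_zero hM fun r => (hann r).2]
  ext x <;> simp [phaseCovector_apply]

theorem controllable_iff_noHiddenMode {n m : ℕ} {M : Matrix (Fin n) (Fin n) ℝ} (hM : M.PosDef)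
    {V : QuadraticForm ℝ (Vec n)} {G : Matrix (Fin n) (Fin m) ℝ} :
    Controllable (linHamField M V G) ↔ NoHiddenMode M (hess V) G Set.univ :=
  ⟨noHiddenMode_of_controllable hM, NoHiddenMode.controllable hM⟩

end Controllability

/-! ### Strict Lyapunov functions from observability. -/

section Lyapunov

variable {X F : Type*} [NormedAddCommGroup X] [NormedSpace ℝ X]
  [NormedAddCommGroup F] [InnerProductSpace ℝ F]

/-- For an output `C` of `x' = A x`, a quadratic form whose derivative along the flow is bounded by
minus the squares of the first derivatives of the output, up to the output itself and a small
multiple of `‖x‖ ^ 2`. -/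
theorem exists_form_lie_le (A : X →L[ℝ] X) (C : X →L[ℝ] F) (k : ℕ) :
    ∀ η > 0, ∃ (P : X →L[ℝ] X →L[ℝ] ℝ) (γ : ℝ), ∀ x, P x (A x) + P (A x) x ≤
      γ * ‖C x‖ ^ 2 + η * ‖x‖ ^ 2 - ∑ j ∈ Finset.range (k + 1), ‖C ((A ^ j) x)‖ ^ 2 := by
  induction k with
  | zero =>
    intro η hη
    refine ⟨0, 1, fun x => ?_⟩
    have : 0 ≤ η * ‖x‖ ^ 2 := by positivity
    simpa using this
  | succ k ih =>
    intro η hη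
    let K := ‖C.comp (A ^ (k + 2))‖
    -- N is the Young constant that bounds the cross term ⟨C Aᵏ x, C Aᵏ⁺² x⟩ by N ‖C Aᵏ x‖² + (η/2)
    -- ‖x‖².
    let N := K ^ 2 / (2 * η) + 1
    have hN : 0 < N := by positivity
    have hKN : K ^ 2 ≤ 2 * η * N := by
      have : 2 * η * N = K ^ 2 + 2 * η := by simp only [N]; field_simp
      linarith
    obtain ⟨P, γ, hP⟩ := ih (η / (2 * (N + 1))) (by positivity)
    let Q : X →L[ℝ] X →L[ℝ] ℝ :=
      (innerSL ℝ).bilinearComp (C.comp (A ^ k)) (C.comp (A ^ (k + 1)))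
    have hQ : ∀ x y, Q x y = inner ℝ (C ((A ^ k) x)) (C ((A ^ (k + 1)) y)) := fun x y => rfl
    -- Subtracting Q produces the new term -‖C Aᵏ⁺¹ x‖². Of the N + 1 copies of P, N absorb the
    -- cross term and one preserves the earlier sum.
    refine ⟨(N + 1) • P - Q, (N + 1) * γ, fun x => ?_⟩
    have h1 := mul_le_mul_of_nonneg_left (hP x) (by positivity : 0 ≤ N + 1)
    have e1 : (A ^ (k + 1)) (A x) = (A ^ (k + 2)) x := by
      rw [pow_succ A (k + 1), mul_apply_eq_comp]
    have e2 : (A ^ k) (A x) = (A ^ (k + 1)) x := by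
      rw [pow_succ A k, mul_apply_eq_comp]
    have h2 : Q x (A x) + Q (A x) x = inner ℝ (C ((A ^ k) x)) (C ((A ^ (k + 2)) x))
        + ‖C ((A ^ (k + 1)) x)‖ ^ 2 := by
      rw [hQ, hQ, e1, e2, real_inner_self_eq_norm_sq]
    set s := ‖C ((A ^ k) x)‖
    set t := ‖C ((A ^ (k + 2)) x)‖
    have h3 : -(s * t) ≤ inner ℝ (C ((A ^ k) x)) (C ((A ^ (k + 2)) x)) :=
      (abs_le.1 (abs_real_inner_le_norm _ _)).1
    have ht : t ≤ K * ‖x‖ := (C.comp (A ^ (k + 2))).le_opNorm x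
    have ht2 : t ^ 2 ≤ 2 * η * N * ‖x‖ ^ 2 := by
      calc t ^ 2 ≤ (K * ‖x‖) ^ 2 := by gcongr
        _ = K ^ 2 * ‖x‖ ^ 2 := by ring
        _ ≤ _ := by gcongr
    have h4 : s * t ≤ N * s ^ 2 + η / 2 * ‖x‖ ^ 2 := by
      have h5 : 0 ≤ (2 * N * s - t) ^ 2 := sq_nonneg _
      have h6 : 4 * N * (s * t) ≤ 4 * N * (N * s ^ 2 + η / 2 * ‖x‖ ^ 2) := by nlinarith
      exact le_of_mul_le_mul_left h6 (by positivity)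
    have h7 : s ^ 2 ≤ ∑ j ∈ Finset.range (k + 1), ‖C ((A ^ j) x)‖ ^ 2 :=
      Finset.single_le_sum (f := fun j => ‖C ((A ^ j) x)‖ ^ 2) (fun _ _ => by positivity)
        (Finset.self_mem_range_succ k)
    have h8 : (N + 1) * (η / (2 * (N + 1)) * ‖x‖ ^ 2) = η / 2 * ‖x‖ ^ 2 := by
      field_simp
    rw [Finset.sum_range_succ _ (k + 1)]
    simp only [sub_apply, smul_apply, smul_eq_mul]
    have h9 := mul_le_mul_of_nonneg_left h7 hN.le
    linarith

/-- The common kernels of C, CA, …, C Aᴺ⁻¹ decrease and stabilize, so finitely many outputs already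
determine x; an injective linear map in finite dimension is bounded below. -/
theorem exists_observability_bound [FiniteDimensional ℝ X] (A : X →L[ℝ] X) (C : X →L[ℝ] F)
    (h : ∀ x, (∀ k : ℕ, C ((A ^ k) x) = 0) → x = 0) :
    ∃ N : ℕ, ∃ c > 0, ∀ x, c * ‖x‖ ^ 2 ≤ ∑ j ∈ Finset.range N, ‖C ((A ^ j) x)‖ ^ 2 := by
  let f : ℕ →o (Submodule ℝ X)ᵒᵈ :=
    ⟨fun N => OrderDual.toDual (⨅ j ∈ Finset.range N, LinearMap.ker (C.comp (A ^ j)).toLinearMap),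
      fun a b hab => OrderDual.toDual_le_toDual.2
        (biInf_mono fun j hj => Finset.range_mono hab hj)⟩
  obtain ⟨N, hN⟩ := IsArtinian.monotone_stabilizes f
  have hbot : ∀ x, (∀ j < N, C ((A ^ j) x) = 0) → x = 0 := by
    intro x hx
    have hxN : x ∈ OrderDual.ofDual (f N) := by
      change x ∈ (⨅ j ∈ Finset.range N, LinearMap.ker (C.comp (A ^ j)).toLinearMap)
      simp only [Submodule.mem_iInf]
      exact fun j hj => hx j (Finset.mem_range.1 hj)
    refine h x fun k => ?_
    rw [hN (max N (k + 1)) (le_max_left _ _)] at hxN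
    change x ∈ (⨅ j ∈ Finset.range (max N (k + 1)),
      LinearMap.ker (C.comp (A ^ j)).toLinearMap) at hxN
    simp only [Submodule.mem_iInf] at hxN
    exact hxN k (by simp)
  let L : X →ₗ[ℝ] (Fin N → F) := LinearMap.pi fun j => (C.comp (A ^ (j : ℕ))).toLinearMap
  have hL : LinearMap.ker L = ⊥ := by
    rw [LinearMap.ker_eq_bot']
    exact fun x hx => hbot x fun j hj => congrFun hx ⟨j, hj⟩
  obtain ⟨K, hK, hKL⟩ := L.exists_antilipschitzWith hL
  refine ⟨N, ((K : ℝ) ^ 2)⁻¹, by positivity, fun x => ?_⟩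
  have h1 : ‖x‖ ≤ K * ‖L x‖ := by
    simpa using hKL.le_mul_dist x 0
  have h2 : ‖L x‖ ≤ √(∑ j ∈ Finset.range N, ‖C ((A ^ j) x)‖ ^ 2) := by
    refine (pi_norm_le_iff_of_nonneg (Real.sqrt_nonneg _)).2 fun j => ?_
    refine Real.le_sqrt_of_sq_le ?_
    exact Finset.single_le_sum (f := fun j => ‖C ((A ^ j) x)‖ ^ 2) (fun _ _ => by positivity)
      (Finset.mem_range.2 j.2)
  have hs : 0 ≤ ∑ j ∈ Finset.range N, ‖C ((A ^ j) x)‖ ^ 2 := by positivity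
  rw [inv_mul_le_iff₀ (by positivity)]
  calc ‖x‖ ^ 2 ≤ (K * √(∑ j ∈ Finset.range N, ‖C ((A ^ j) x)‖ ^ 2)) ^ 2 := by
        gcongr
        exact h1.trans (by gcongr)
    _ = _ := by rw [mul_pow, Real.sq_sqrt hs]

/-- A strict quadratic Lyapunov function for a dissipative perturbation of an observable linear
system. -/
theorem exists_strict_lyapunov [FiniteDimensional ℝ X] (A : X →L[ℝ] X) (C : X →L[ℝ] F)
    (h : ∀ x, (∀ k : ℕ, C ((A ^ k) x) = 0) → x = 0) (Q : X →L[ℝ] X →L[ℝ] ℝ) {c₁ : ℝ}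
    (hc₁ : 0 < c₁) (hQ : ∀ x, c₁ * ‖x‖ ^ 2 ≤ Q x x) {f : X → X} {Ω : Set X} {k κ : ℝ}
    (hk : 0 < k) (hQf : ∀ x ∈ Ω, Q x (f x) + Q (f x) x ≤ -(k * ‖C x‖ ^ 2))
    (hf : ∀ x ∈ Ω, ‖f x - A x‖ ≤ κ * ‖C x‖) :
    ∃ L : X →L[ℝ] X →L[ℝ] ℝ, ∃ c > 0, ∃ ρ > 0, (∀ x, ‖x‖ ^ 2 ≤ L x x ∧ L x x ≤ c * ‖x‖ ^ 2) ∧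
      ∀ x ∈ Ω, L x (f x) + L (f x) x ≤ -(ρ * L x x) := by
  obtain ⟨N, c₀, hc₀, hN⟩ := exists_observability_bound A C h
  obtain ⟨P, γ, hP⟩ := exists_form_lie_le A C N (c₀ / 2) (by positivity)
  have hPA : ∀ x, P x (A x) + P (A x) x ≤ γ * ‖C x‖ ^ 2 - c₀ / 2 * ‖x‖ ^ 2 := by
    intro x
    have h1 := hP x
    rw [Finset.sum_range_succ] at h1
    have h2 := hN x
    have h3 : 0 ≤ ‖C ((A ^ N) x)‖ ^ 2 := by positivity
    linarith
  have hle : ∀ (R : X →L[ℝ] X →L[ℝ] ℝ) x y, |R x y| ≤ ‖R‖ * ‖x‖ * ‖y‖ := fun R x y =>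
    R.le_opNorm₂ x y
  let γ' := |γ| + 4 * ‖P‖ ^ 2 * κ ^ 2 / c₀
  have hPf : ∀ x ∈ Ω, P x (f x) + P (f x) x ≤ γ' * ‖C x‖ ^ 2 - c₀ / 4 * ‖x‖ ^ 2 := by
    intro x hx
    have e : P x (f x) + P (f x) x
        = P x (A x) + P (A x) x + (P x (f x - A x) + P (f x - A x) x) := by
      simp only [map_sub, sub_apply]
      ring
    have hw := hf x hx
    have h1 : P x (f x - A x) ≤ ‖P‖ * ‖x‖ * (κ * ‖C x‖) :=
      (le_abs_self _).trans ((hle P _ _).trans (by gcongr))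
    have h2 : P (f x - A x) x ≤ ‖P‖ * (κ * ‖C x‖) * ‖x‖ :=
      (le_abs_self _).trans ((hle P _ _).trans (by gcongr))
    have h3 : 2 * (‖P‖ * κ * ‖C x‖ * ‖x‖)
        ≤ c₀ / 4 * ‖x‖ ^ 2 + 4 * ‖P‖ ^ 2 * κ ^ 2 / c₀ * ‖C x‖ ^ 2 := by
      have h4 : 0 ≤ (c₀ * ‖x‖ - 4 * (‖P‖ * κ * ‖C x‖)) ^ 2 / (4 * c₀) := by positivity
      have h5 : (c₀ * ‖x‖ - 4 * (‖P‖ * κ * ‖C x‖)) ^ 2 / (4 * c₀) = c₀ / 4 * ‖x‖ ^ 2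
          + 4 * ‖P‖ ^ 2 * κ ^ 2 / c₀ * ‖C x‖ ^ 2 - 2 * (‖P‖ * κ * ‖C x‖ * ‖x‖) := by
        field_simp
        ring
      linarith
    have h6 : γ * ‖C x‖ ^ 2 ≤ |γ| * ‖C x‖ ^ 2 := by
      gcongr
      exact le_abs_self γ
    have h7 := hPA x
    simp only [γ', add_mul]
    linarith
  -- The first summand lets the dissipation of Q absorb γ' ‖C x‖²; the second makes b Q + P at least
  -- ‖x‖².
  let b := γ' / k + (‖P‖ + 1) / c₁
  have hγ' : 0 ≤ γ' := by positivity
  have hb : 0 ≤ b := by positivity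
  have hbk : γ' ≤ b * k := by
    have : b * k = γ' + (‖P‖ + 1) / c₁ * k := by simp only [b]; field_simp
    have : 0 ≤ (‖P‖ + 1) / c₁ * k := by positivity
    linarith
  have hbc : ‖P‖ + 1 ≤ b * c₁ := by
    have : b * c₁ = γ' / k * c₁ + (‖P‖ + 1) := by simp only [b]; field_simp
    have : 0 ≤ γ' / k * c₁ := by positivity
    linarith
  let L := b • Q + P
  have hL : ∀ x y, L x y = b * Q x y + P x y := fun x y => rfl
  have hup : ∀ x, L x x ≤ (‖L‖ + 1) * ‖x‖ ^ 2 := fun x => by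
    have h1 := (le_abs_self _).trans (hle L x x)
    have h2 : 0 ≤ ‖x‖ ^ 2 := by positivity
    linarith
  refine ⟨L, ‖L‖ + 1, by positivity, c₀ / 4 / (‖L‖ + 1), by positivity,
    fun x => ⟨?_, hup x⟩, fun x hx => ?_⟩
  · have h1 := (abs_le.1 (hle P x x)).1
    have h2 := mul_le_mul_of_nonneg_left (hQ x) hb
    have h3 := mul_le_mul_of_nonneg_right hbc (by positivity : 0 ≤ ‖x‖ ^ 2)
    rw [hL]
    linarith
  · have h1 := mul_le_mul_of_nonneg_left (hQf x hx) hb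
    have h2 := hPf x hx
    have h3 := mul_le_mul_of_nonneg_right hbk (by positivity : 0 ≤ ‖C x‖ ^ 2)
    have h4 := mul_le_mul_of_nonneg_left (hup x)
      (by positivity : 0 ≤ c₀ / 4 / (‖L‖ + 1))
    have h5 : c₀ / 4 / (‖L‖ + 1) * ((‖L‖ + 1) * ‖x‖ ^ 2) = c₀ / 4 * ‖x‖ ^ 2 := by
      have : ‖L‖ + 1 ≠ 0 := by positivity
      field_simp
    rw [hL, hL]
    linarith

/-- The function exp(ρt) L(x, x) is nonincreasing along the solution. Nothing is assumed about the
sign of ρ; ρ = 0 serves for plain energy decay. -/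
theorem IsSolution.form_le {f : X → X} {T : ℝ} {x : ℝ → X} (hx : IsSolution f T x)
    (L : X →L[ℝ] X →L[ℝ] ℝ) {ρ : ℝ}
    (hL : ∀ t ∈ Set.Icc 0 T, L (x t) (f (x t)) + L (f (x t)) (x t) ≤ -(ρ * L (x t) (x t)))
    (t : ℝ) (ht : t ∈ Set.Icc 0 T) : L (x t) (x t) ≤ Real.exp (-ρ * t) * L (x 0) (x 0) := by
  have hd : ∀ t ∈ Set.Icc 0 T, HasDerivWithinAt (fun t => Real.exp (ρ * t) * L (x t) (x t))
      (Real.exp (ρ * t) * (ρ * L (x t) (x t) + (L (x t) (f (x t)) + L (f (x t)) (x t))))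
      (Set.Icc 0 T) t := by
    intro t ht
    have h1 := (L.hasFDerivAt.comp_hasDerivWithinAt t (hx t ht)).clm_apply (hx t ht)
    have h2 : HasDerivWithinAt (fun t => Real.exp (ρ * t)) (Real.exp (ρ * t) * ρ)
        (Set.Icc 0 T) t := by
      simpa using (((hasDerivAt_id t).const_mul ρ).exp).hasDerivWithinAt
    refine (h2.mul h1).congr_deriv ?_
    simp only [Function.comp_apply]
    ring
  have hanti := antitoneOn_of_hasDerivWithinAt_nonpos (convex_Icc 0 T)
    (fun t ht => (hd t ht).continuousWithinAt)
    (fun t ht => (hd t (interior_subset ht)).mono interior_subset) fun t ht => by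
      have := hL t (interior_subset ht)
      exact mul_nonpos_of_nonneg_of_nonpos (Real.exp_pos _).le (by linarith)
  have h0 := hanti (Set.left_mem_Icc.2 (ht.1.trans ht.2)) ht ht.1
  simp only [mul_zero, Real.exp_zero, one_mul] at h0
  rw [neg_mul, Real.exp_neg, le_inv_mul_iff₀ (Real.exp_pos _)]
  exact h0

theorem exists_exp_bound_of_dissipative [FiniteDimensional ℝ X] (A : X →L[ℝ] X) (C : X →L[ℝ] F)
    (h : ∀ x, (∀ k : ℕ, C ((A ^ k) x) = 0) → x = 0) (Q : X →L[ℝ] X →L[ℝ] ℝ) {c₁ : ℝ}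
    (hc₁ : 0 < c₁) (hQ : ∀ x, c₁ * ‖x‖ ^ 2 ≤ Q x x) {f : X → X} {Ω : Set X} {k κ : ℝ}
    (hk : 0 < k) (hQf : ∀ x ∈ Ω, Q x (f x) + Q (f x) x ≤ -(k * ‖C x‖ ^ 2))
    (hf : ∀ x ∈ Ω, ‖f x - A x‖ ≤ κ * ‖C x‖) :
    ∃ c > 0, ∃ lam > 0, ∀ (T : ℝ) (x : ℝ → X), IsSolution f T x →
      (∀ t ∈ Set.Icc 0 T, x t ∈ Ω) →
      ∀ t ∈ Set.Icc 0 T, ‖x t‖ ≤ c * Real.exp (-lam * t) * ‖x 0‖ := by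
  obtain ⟨L, c, hc, ρ, hρ, hL, hLf⟩ := exists_strict_lyapunov A C h Q hc₁ hQ hk hQf hf
  refine ⟨√c, Real.sqrt_pos.2 hc, ρ / 2, by positivity, fun T x hx hxΩ t ht => ?_⟩
  have h1 := hx.form_le L (fun t ht => hLf _ (hxΩ t ht)) t ht
  refine (pow_le_pow_iff_left₀ (norm_nonneg _) (by positivity) two_ne_zero).1 ?_
  have h2 : Real.exp (-ρ * t) = Real.exp (-(ρ / 2) * t) ^ 2 := by
    rw [sq, ← Real.exp_add]
    congr 1
    ring
  calc ‖x t‖ ^ 2 ≤ L (x t) (x t) := (hL _).1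
    _ ≤ Real.exp (-ρ * t) * L (x 0) (x 0) := h1
    _ ≤ Real.exp (-ρ * t) * (c * ‖x 0‖ ^ 2) := by
      gcongr
      exact (hL _).2
    _ = _ := by rw [h2, mul_pow, mul_pow, Real.sq_sqrt hc.le]; ring

/-- Bounds for a continuous family of quadratically homogeneous functions over a compact set. -/
theorem exists_quadratic_bounds {Y W : Type*} [TopologicalSpace Y] [NormedAddCommGroup W]
    [NormedSpace ℝ W] [FiniteDimensional ℝ W] {S : Set Y} (hS : IsCompact S) {g : Y → W → ℝ}
    (hg : Continuous fun z : Y × W => g z.1 z.2)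
    (hh : ∀ q (r : ℝ) v, g q (r • v) = r ^ 2 * g q v) :
    (∃ κ ≥ 0, ∀ q ∈ S, ∀ v, g q v ≤ κ * ‖v‖ ^ 2) ∧
      ((∀ q ∈ S, ∀ v, v ≠ 0 → 0 < g q v) → ∃ k > 0, ∀ q ∈ S, ∀ v, k * ‖v‖ ^ 2 ≤ g q v) := by
  have hscale : ∀ q v, v ≠ 0 → ‖v‖⁻¹ • v ∈ Metric.sphere (0 : W) 1 ∧
      g q v = ‖v‖ ^ 2 * g q (‖v‖⁻¹ • v) := by
    intro q v hv
    have hv' : ‖v‖ ≠ 0 := norm_ne_zero_iff.2 hv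
    refine ⟨by simp [norm_smul, hv'], ?_⟩
    rw [← hh, smul_smul, mul_inv_cancel₀ hv', one_smul]
  have hz : ∀ q, g q 0 = 0 := fun q => by simpa using hh q 0 0
  have hcomp : IsCompact (S ×ˢ Metric.sphere (0 : W) 1) := hS.prod (isCompact_sphere 0 1)
  constructor
  · obtain ⟨κ, hκ⟩ := hcomp.exists_bound_of_continuousOn hg.continuousOn
    refine ⟨max κ 0, le_max_right _ _, fun q hq v => ?_⟩
    by_cases hv : v = 0
    · simp [hv, hz]
    · obtain ⟨h1, h2⟩ := hscale q v hv
      rw [h2, mul_comm (max κ 0)]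
      gcongr
      exact ((le_abs_self _).trans (hκ (q, _) ⟨hq, h1⟩)).trans (le_max_left _ _)
  · intro hpos
    -- The product can be empty, for instance when W is trivial (no inputs).
    rcases (S ×ˢ Metric.sphere (0 : W) 1).eq_empty_or_nonempty with he | hne
    · refine ⟨1, one_pos, fun q hq v => ?_⟩
      by_cases hv : v = 0
      · simp [hv, hz]
      · exact absurd (show (q, ‖v‖⁻¹ • v) ∈ S ×ˢ Metric.sphere (0 : W) 1 from
          ⟨hq, (hscale q v hv).1⟩) (by rw [he]; simp)
    · obtain ⟨⟨q₀, v₀⟩, hmem, hmin⟩ := hcomp.exists_isMinOn hne hg.continuousOn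
      have hv₀ : v₀ ≠ 0 := fun h0 => by simpa [h0] using hmem.2
      refine ⟨g q₀ v₀, hpos q₀ hmem.1 v₀ hv₀, fun q hq v => ?_⟩
      by_cases hv : v = 0
      · simp [hv, hz]
      · obtain ⟨h1, h2⟩ := hscale q v hv
        rw [h2, mul_comm]
        gcongr
        exact hmin (show (q, ‖v‖⁻¹ • v) ∈ S ×ˢ Metric.sphere (0 : W) 1 from ⟨hq, h1⟩)

end Lyapunov

/-! ### Stability of the closed loop. -/

section ClosedLoop

variable {n m : ℕ} {M : Matrix (Fin n) (Fin n) ℝ} {V : QuadraticForm ℝ (Vec n)}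
  {G : Matrix (Fin n) (Fin m) ℝ} {Mhat : Matrix (Fin n) (Fin n) ℝ}
  {Vhat : QuadraticForm ℝ (Vec n)} {Kv : Vec n → Matrix (Fin m) (Fin m) ℝ}

/-- A hidden mode persists as an undamped oscillation of the closed loop. -/
theorem TransformsTo.noHiddenMode_of_expStable (h : TransformsTo M V G Mhat Vhat Kv)
    (hM : M.PosDef) (hs : ExpStable (linDesiredField M G Mhat Vhat Kv)) :
    NoHiddenMode M (hess V) G Set.univ := by
  intro e _ z hz hGz
  by_contra hz0
  have he : 0 < e := by
    by_contra! he
    exact hz0 (h.noHiddenMode hM e he z hz hGz)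
  set w := √e
  have hw : 0 < w := Real.sqrt_pos.2 he
  have hw2 : w * w = e := Real.mul_self_sqrt he.le
  obtain ⟨δ, hδ, c, hc, lam, hlam, hstab⟩ := hs
  let y := M⁻¹ *ᵥ (Mhat *ᵥ z)
  have hy : hess Vhat *ᵥ y = e • (M *ᵥ z) := by rw [← hz, h.hess_mulVec hM hGz]
  have hy0 : y ≠ 0 := fun h0 => hz0 (by
    rw [← inv_mulVec_mulVec h.posDef_Mhat z, ← mulVec_inv_mulVec hM (Mhat *ᵥ z)]
    change Mhat⁻¹ *ᵥ (M *ᵥ y) = 0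
    rw [h0, Matrix.mulVec_zero, Matrix.mulVec_zero])
  -- Scales the periodic orbit to start at norm δ/2, inside the stability region.
  let ε := δ / (2 * ‖y‖)
  have hyn : 0 < ‖y‖ := norm_pos_iff.2 hy0
  have hε : 0 < ε := by positivity
  let x : ℝ → Phase n := fun t =>
    ((ε * Real.cos (w * t)) • y, (-(ε * w * Real.sin (w * t))) • (Mhat *ᵥ z))
  have hsol : ∀ T, IsSolution (linDesiredField M G Mhat Vhat Kv) T x := by
    intro T t _
    have hwt : HasDerivAt (fun t => w * t) w t := by
      simpa using (hasDerivAt_id t).const_mul w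
    have h1 : HasDerivAt (fun t => (ε * Real.cos (w * t)) • y)
        ((ε * (-Real.sin (w * t) * w)) • y) t := (hwt.cos.const_mul ε).smul_const y
    have h2 : HasDerivAt (fun t => (-(ε * w * Real.sin (w * t))) • (Mhat *ᵥ z))
        ((-(ε * w * (Real.cos (w * t) * w))) • (Mhat *ᵥ z)) t :=
      ((hwt.sin.const_mul (ε * w)).neg).smul_const _
    refine ((h1.prodMk h2).congr_deriv ?_).hasDerivWithinAt
    rw [linDesiredField_eq M G h.posDef_Mhat]
    refine Prod.ext ?_ ?_
    · simp only [x, Matrix.mulVec_smul]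
      change _ = (-(ε * w * Real.sin (w * t))) • y
      congr 1
      ring
    · simp only [x, Matrix.mulVec_smul, hy, inv_mulVec_mulVec hM, inv_mulVec_mulVec h.posDef_Mhat,
        hGz, smul_zero, Matrix.mulVec_zero, sub_zero, smul_smul, ← neg_smul, ← hw2]
      congr 1
      ring
  have hx0 : x 0 = (ε • y, 0) := by simp [x]
  have hnorm : ‖x 0‖ = δ / 2 := by
    rw [hx0, Prod.norm_mk, norm_zero, max_eq_left (norm_nonneg _), norm_smul, Real.norm_eq_abs,
      abs_of_pos hε]
    simp only [ε]
    field_simp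
  -- Enough full periods that the exponential bound falls below the initial norm, to which the orbit
  -- has returned.
  obtain ⟨k, hk⟩ := exists_nat_gt (c * w / (2 * Real.pi * lam))
  let t := 2 * Real.pi * k / w
  have ht : 0 ≤ t := by positivity
  have hwt : w * t = k * (2 * Real.pi) := by
    simp only [t]
    field_simp
  have hxt : x t = x 0 := by
    simp only [x, hwt, mul_zero, Real.cos_nat_mul_two_pi, Real.cos_zero, Real.sin_zero]
    rw [show (k : ℝ) * (2 * Real.pi) = ((2 * k : ℕ) : ℝ) * Real.pi by push_cast; ring,
      Real.sin_nat_mul_pi, mul_zero]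
  have hb := hstab t x (hsol t) (by rw [hnorm]; linarith) t (Set.right_mem_Icc.2 ht)
  rw [hxt, hnorm] at hb
  have h1 : c < lam * t := by
    rw [div_lt_iff₀ (by positivity)] at hk
    simp only [t]
    rw [← mul_div_assoc, lt_div_iff₀ hw]
    linarith
  have h2 : c < Real.exp (lam * t) := h1.trans ((lt_add_one _).trans_le (Real.add_one_le_exp _))
  have h3 : c * Real.exp (-lam * t) < 1 := by
    rw [neg_mul, Real.exp_neg, ← div_eq_mul_inv, div_lt_one (Real.exp_pos _)]
    exact h2
  nlinarith

/-- The closed loop without damping. -/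
def conservativeMap (M Mhat : Matrix (Fin n) (Fin n) ℝ) (Vhat : QuadraticForm ℝ (Vec n)) :
    Phase n →L[ℝ] Phase n :=
  (LinearMap.prod ((M⁻¹).mulVecLin ∘ₗ LinearMap.snd ℝ (Vec n) (Vec n))
    (-((Mhat * M⁻¹ * hess Vhat).mulVecLin ∘ₗ
      LinearMap.fst ℝ (Vec n) (Vec n)))).toContinuousLinearMap

theorem conservativeMap_apply (x : Phase n) : conservativeMap M Mhat Vhat x =
    (M⁻¹ *ᵥ x.2, -(Mhat *ᵥ (M⁻¹ *ᵥ (hess Vhat *ᵥ x.1)))) := by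
  rw [Matrix.mulVec_mulVec, Matrix.mulVec_mulVec]
  rfl

/-- The output `Gᵀ Mhat⁻¹ p` through which the damping acts. -/
def dampingOutput (G : Matrix (Fin n) (Fin m) ℝ) (Mhat : Matrix (Fin n) (Fin n) ℝ) :
    Phase n →L[ℝ] EuclideanSpace ℝ (Fin m) :=
  ((WithLp.linearEquiv 2 ℝ (Vec m)).symm.toLinearMap ∘ₗ (Gᵀ * Mhat⁻¹).mulVecLin ∘ₗ
    LinearMap.snd ℝ (Vec n) (Vec n)).toContinuousLinearMap

theorem dampingOutput_apply (x : Phase n) :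
    dampingOutput G Mhat x = WithLp.toLp 2 (Gᵀ *ᵥ (Mhat⁻¹ *ᵥ x.2)) := by
  rw [Matrix.mulVec_mulVec]
  rfl

/-- The polar form of twice the closed-loop energy. -/
def energyForm (Mhat : Matrix (Fin n) (Fin n) ℝ) (Vhat : QuadraticForm ℝ (Vec n)) :
    Phase n →L[ℝ] Phase n →L[ℝ] ℝ :=
  LinearMap.toContinuousLinearMap (LinearMap.toContinuousLinearMap.toLinearMap ∘ₗ
    LinearMap.mk₂ ℝ (fun x y : Phase n => x.1 ⬝ᵥ (hess Vhat *ᵥ y.1) + x.2 ⬝ᵥ (Mhat⁻¹ *ᵥ y.2))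
      (fun x x' y => by simp only [Prod.fst_add, Prod.snd_add, add_dotProduct]; ring)
      (fun c x y => by simp [mul_add])
      (fun x y y' => by
        simp only [Prod.fst_add, Prod.snd_add, Matrix.mulVec_add, dotProduct_add]; ring)
      (fun c x y => by simp [mul_add, Matrix.mulVec_smul]))

theorem energyForm_apply (x y : Phase n) : energyForm Mhat Vhat x y =
    x.1 ⬝ᵥ (hess Vhat *ᵥ y.1) + x.2 ⬝ᵥ (Mhat⁻¹ *ᵥ y.2) := rfl

theorem energyForm_comm (hMhat : Mhat.PosDef) (x y : Phase n) :
    energyForm Mhat Vhat x y = energyForm Mhat Vhat y x := by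
  rw [energyForm_apply, energyForm_apply, dotProduct_mulVec_comm (hess_isSymm Vhat),
    dotProduct_mulVec_comm (isSymm_of_posDef hMhat.inv), dotProduct_comm, dotProduct_comm y.2,
    dotProduct_comm y.1]

/-- The terms containing M⁻¹ cancel by skew-symmetry of the interconnection; only the damping
remains. -/
theorem TransformsTo.energy_rate (h : TransformsTo M V G Mhat Vhat Kv) (hM : M.PosDef)
    (x : Phase n) :
    energyForm Mhat Vhat x (linDesiredField M G Mhat Vhat Kv x)
      + energyForm Mhat Vhat (linDesiredField M G Mhat Vhat Kv x) x =
    -(2 * ((Gᵀ *ᵥ (Mhat⁻¹ *ᵥ x.2)) ⬝ᵥ (Kv x.1 *ᵥ (Gᵀ *ᵥ (Mhat⁻¹ *ᵥ x.2))))) := by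
  rw [energyForm_comm h.posDef_Mhat (linDesiredField M G Mhat Vhat Kv x), energyForm_apply,
    linDesiredField_eq M G h.posDef_Mhat]
  have h1 : x.1 ⬝ᵥ (hess Vhat *ᵥ (M⁻¹ *ᵥ x.2))
      = x.2 ⬝ᵥ (M⁻¹ *ᵥ (hess Vhat *ᵥ x.1)) := by
    rw [dotProduct_mulVec_comm (hess_isSymm Vhat),
      dotProduct_mulVec_comm (isSymm_of_posDef hM.inv), dotProduct_comm]
  have h2 : ∀ w, x.2 ⬝ᵥ (Mhat⁻¹ *ᵥ (G *ᵥ w)) = (Gᵀ *ᵥ (Mhat⁻¹ *ᵥ x.2)) ⬝ᵥ w := by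
    intro w
    rw [dotProduct_mulVec_comm (isSymm_of_posDef h.posDef_Mhat.inv), Matrix.dotProduct_mulVec,
      ← Matrix.mulVec_transpose]
  simp only [Matrix.mulVec_sub, Matrix.mulVec_neg, inv_mulVec_mulVec h.posDef_Mhat,
    dotProduct_sub, dotProduct_neg, h1, h2]
  ring

/-- While the output vanishes, matching replaces Ŝ M⁻¹ M̂ by S, so unobservable states of the
undamped closed loop are governed by the original modes, none of which is hidden. -/
theorem TransformsTo.observable (h : TransformsTo M V G Mhat Vhat Kv) (hM : M.PosDef)
    (hH : NoHiddenMode M (hess V) G Set.univ) (x : Phase n)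
    (hx : ∀ k : ℕ, dampingOutput G Mhat ((conservativeMap M Mhat Vhat ^ k) x) = 0) : x = 0 := by
  set A := conservativeMap M Mhat Vhat with hA
  have hout : ∀ x, dampingOutput G Mhat x = 0 → Gᵀ *ᵥ (Mhat⁻¹ *ᵥ x.2) = 0 := by
    intro x hx
    rw [dampingOutput_apply] at hx
    simpa using hx
  -- Stated for all x because it is applied again to A x, whose momentum determines the position.
  have key : ∀ x : Phase n, (∀ k : ℕ, dampingOutput G Mhat ((A ^ k) x) = 0) → x.2 = 0 := by
    intro x hx
    have hk : ∀ k : ℕ, Mhat⁻¹ *ᵥ ((A ^ (2 * k)) x).2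
        = (-1 : ℝ) ^ k • (freqOp M (hess V) ^ k) (Mhat⁻¹ *ᵥ x.2) := by
      intro k
      induction k with
      | zero => simp
      | succ k ih =>
        have hGk := hout _ (hx (2 * k))
        have e1 : (A ^ (2 * (k + 1))) x = A (A ((A ^ (2 * k)) x)) := by
          rw [show 2 * (k + 1) = 2 * k + 1 + 1 by ring, pow_succ', pow_succ', mul_apply_eq_comp,
            mul_apply_eq_comp]
        have e2 := h.hess_mulVec hM hGk
        rw [mulVec_inv_mulVec h.posDef_Mhat, ih] at e2
        rw [e1, hA, conservativeMap_apply, conservativeMap_apply, ← hA]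
        simp only [Matrix.mulVec_neg, inv_mulVec_mulVec h.posDef_Mhat]
        rw [← e2, pow_succ' (freqOp M (hess V)), Module.End.mul_apply, pow_succ, mul_neg_one,
          neg_smul, Matrix.mulVec_smul, Matrix.mulVec_smul, freqOp, Matrix.mulVecLin_apply,
          ← Matrix.mulVec_mulVec]
    have hz : Mhat⁻¹ *ᵥ x.2 = 0 := by
      refine hH.eq_zero hM fun r => ?_
      rw [Polynomial.aeval_eq_sum_range, LinearMap.sum_apply, Matrix.mulVec_sum]
      refine Finset.sum_eq_zero fun k _ => ?_
      have hGk := hout _ (hx (2 * k))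
      rw [hk, Matrix.mulVec_smul, smul_eq_zero] at hGk
      rw [LinearMap.smul_apply, Matrix.mulVec_smul, hGk.resolve_left (by simp), smul_zero]
    rw [← mulVec_inv_mulVec h.posDef_Mhat x.2, hz, Matrix.mulVec_zero]
  have hp := key x hx
  have hq := key (A x) fun k => by
    have := hx (k + 1)
    rwa [pow_succ, mul_apply_eq_comp] at this
  rw [hA, conservativeMap_apply, neg_eq_zero] at hq
  refine Prod.ext ?_ hp
  have h1 : hess Vhat *ᵥ x.1 = 0 := by
    rw [← mulVec_inv_mulVec hM (hess Vhat *ᵥ x.1),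
      ← inv_mulVec_mulVec h.posDef_Mhat (M⁻¹ *ᵥ (hess Vhat *ᵥ x.1)), hq, Matrix.mulVec_zero,
      Matrix.mulVec_zero]
  rw [← inv_mulVec_mulVec (hess_posDef h.posDef_Vhat) x.1, h1, Matrix.mulVec_zero]
  rfl

theorem TransformsTo.energyForm_coercive (h : TransformsTo M V G Mhat Vhat Kv) :
    ∃ c > 0, ∀ x, c * ‖x‖ ^ 2 ≤ energyForm Mhat Vhat x x := by
  -- A one-point parameter space; only compactness of the unit sphere is needed.
  obtain ⟨c, hc, hb⟩ := (exists_quadratic_bounds (Y := Unit) (S := Set.univ) isCompact_univ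
    (g := fun _ x => energyForm Mhat Vhat x x)
    (((energyForm Mhat Vhat).continuous.comp continuous_snd).clm_apply continuous_snd)
    (fun _ r v => by simp; ring)).2 fun _ _ v hv => by
      have hnn : ∀ {A : Matrix (Fin n) (Fin n) ℝ} (_ : A.PosDef) (w : Vec n),
          0 ≤ w ⬝ᵥ (A *ᵥ w) := fun hA w => by simpa using hA.posSemidef.dotProduct_mulVec_nonneg w
      have h1 := hess_posDef h.posDef_Vhat
      have h2 := h.posDef_Mhat.inv
      rw [energyForm_apply]
      by_cases hv1 : v.1 = 0
      · have hv2 : v.2 ≠ 0 := fun h0 => hv (Prod.ext hv1 h0)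
        exact add_pos_of_nonneg_of_pos (hnn h1 _) (dotProduct_pos_of_posDef h2 hv2)
      · exact add_pos_of_pos_of_nonneg (dotProduct_pos_of_posDef h1 hv1) (hnn h2 _)
  exact ⟨c, hc, fun x => hb () trivial x⟩

/-- Uniform exponential decay along closed-loop solutions whose gain stays in the image of a
compact set of positions. -/
theorem TransformsTo.exists_exp_bound (h : TransformsTo M V G Mhat Vhat Kv) (hM : M.PosDef)
    (hH : NoHiddenMode M (hess V) G Set.univ) {S : Set (Vec n)} (hS : IsCompact S)
    {Ω : Set (Phase n)} (hΩ : ∀ x ∈ Ω, ∃ q ∈ S, Kv x.1 = Kv q) :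
    ∃ c > 0, ∃ lam > 0, ∀ (T : ℝ) (x : ℝ → Phase n),
      IsSolution (linDesiredField M G Mhat Vhat Kv) T x → (∀ t ∈ Set.Icc 0 T, x t ∈ Ω) →
      ∀ t ∈ Set.Icc 0 T, ‖x t‖ ≤ c * Real.exp (-lam * t) * ‖x 0‖ := by
  have hKc : Continuous Kv := continuous_matrix fun i j => (h.smooth_Kv i j).continuous
  have hv : Continuous fun z : Vec n × EuclideanSpace ℝ (Fin m) => WithLp.ofLp z.2 :=
    (PiLp.continuous_ofLp 2 _).comp continuous_snd
  have hKv : Continuous fun z : Vec n × EuclideanSpace ℝ (Fin m) =>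
      Kv z.1 *ᵥ WithLp.ofLp z.2 := (hKc.comp continuous_fst).matrix_mulVec hv
  obtain ⟨k, hk, hkb⟩ := (exists_quadratic_bounds hS
    (g := fun q (v : EuclideanSpace ℝ (Fin m)) => WithLp.ofLp v ⬝ᵥ (Kv q *ᵥ WithLp.ofLp v))
    (hv.dotProduct hKv) (fun q r v => by simp [Matrix.mulVec_smul]; ring)).2
    fun q _ v hv0 => dotProduct_pos_of_posDef (h.posDef_Kv q) (by simpa using hv0)
  obtain ⟨κ, hκ, hκb⟩ := (exists_quadratic_bounds hS
    (g := fun q (v : EuclideanSpace ℝ (Fin m)) => ‖G *ᵥ (Kv q *ᵥ WithLp.ofLp v)‖ ^ 2)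
    ((continuous_const.matrix_mulVec hKv).norm.pow 2)
    (fun q r v => by simp [Matrix.mulVec_smul, norm_smul, mul_pow])).1
  obtain ⟨c₁, hc₁, hQ⟩ := h.energyForm_coercive
  refine exists_exp_bound_of_dissipative (conservativeMap M Mhat Vhat) (dampingOutput G Mhat)
    (h.observable hM hH) (energyForm Mhat Vhat) hc₁ hQ hk (κ := √κ) (fun x hx => ?_)
    fun x hx => ?_
  · obtain ⟨q, hq, hKq⟩ := hΩ x hx
    have h1 := hkb q hq (dampingOutput G Mhat x)
    have h2 : 0 ≤ k * ‖dampingOutput G Mhat x‖ ^ 2 := by positivity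
    rw [h.energy_rate hM, hKq]
    rw [dampingOutput_apply] at h1 h2 ⊢
    simp only at h1
    linarith
  · obtain ⟨q, hq, hKq⟩ := hΩ x hx
    have h1 := hκb q hq (dampingOutput G Mhat x)
    have h2 : linDesiredField M G Mhat Vhat Kv x - conservativeMap M Mhat Vhat x
        = (0, -(G *ᵥ (Kv q *ᵥ WithLp.ofLp (dampingOutput G Mhat x)))) := by
      rw [linDesiredField_eq M G h.posDef_Mhat, conservativeMap_apply, dampingOutput_apply, hKq]
      refine Prod.ext (sub_self _) ?_
      simp only [Prod.snd_sub]
      abel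
    rw [h2, Prod.norm_mk, norm_zero, norm_neg, max_eq_right (norm_nonneg _)]
    refine (pow_le_pow_iff_left₀ (norm_nonneg _) (by positivity) two_ne_zero).1 ?_
    rw [mul_pow, Real.sq_sqrt hκ]
    exact h1

/-- The gain is uniformly bounded only over compact sets of positions. Since the energy does not
increase, solutions that start close enough to 0 stay in the unit ball, where the uniform estimate
applies. -/
theorem TransformsTo.expStable (h : TransformsTo M V G Mhat Vhat Kv) (hM : M.PosDef)
    (hH : NoHiddenMode M (hess V) G Set.univ) :
    ExpStable (linDesiredField M G Mhat Vhat Kv) := by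
  obtain ⟨c, hc, lam, hlam, hb⟩ := h.exists_exp_bound hM hH
    (isCompact_closedBall (0 : Vec n) 1) (Ω := Metric.closedBall 0 1) fun x hx =>
      ⟨x.1, by
        rw [mem_closedBall_zero_iff] at hx ⊢
        exact (norm_fst_le x).trans hx, rfl⟩
  obtain ⟨c₁, hc₁, hQ⟩ := h.energyForm_coercive
  set E := energyForm Mhat Vhat
  refine ⟨√(c₁ / (‖E‖ + 1)), by positivity, c, hc, lam, hlam, fun T x hx hx0 => ?_⟩
  refine hb T x hx fun t ht => ?_
  have h1 := hx.form_le E (ρ := 0) (fun t _ => by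
    rw [h.energy_rate hM, zero_mul, neg_zero, neg_nonpos]
    have := (h.posDef_Kv (x t).1).posSemidef.dotProduct_mulVec_nonneg
      (Gᵀ *ᵥ (Mhat⁻¹ *ᵥ (x t).2))
    rw [star_trivial] at this
    positivity) t ht
  rw [neg_zero, zero_mul, Real.exp_zero, one_mul] at h1
  have h2 : E (x 0) (x 0) ≤ ‖E‖ * ‖x 0‖ * ‖x 0‖ := (le_abs_self _).trans (E.le_opNorm₂ _ _)
  have h3 : ‖x 0‖ ^ 2 ≤ c₁ / (‖E‖ + 1) := by
    rw [← Real.sq_sqrt (show 0 ≤ c₁ / (‖E‖ + 1) by positivity)]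
    gcongr
  have h4 : (‖E‖ + 1) * ‖x 0‖ ^ 2 ≤ c₁ := by
    rwa [le_div_iff₀' (by positivity)] at h3
  have h5 := hQ (x t)
  have h6 : c₁ * ‖x t‖ ^ 2 ≤ c₁ * 1 := by nlinarith [sq_nonneg ‖x 0‖]
  have h7 : ‖x t‖ ^ 2 ≤ 1 := le_of_mul_le_mul_left h6 hc₁
  rw [mem_closedBall_zero_iff]
  exact (sq_le_one_iff₀ (norm_nonneg _)).1 h7

theorem TransformsTo.globExpStable {K : Matrix (Fin m) (Fin m) ℝ}
    (h : TransformsTo M V G Mhat Vhat (fun _ => K)) (hM : M.PosDef)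
    (hH : NoHiddenMode M (hess V) G Set.univ) :
    GlobExpStable (linDesiredField M G Mhat Vhat (fun _ => K)) := by
  -- A constant gain takes its only value at 0, so the estimate holds on all of phase space.
  obtain ⟨c, hc, lam, hlam, hb⟩ := h.exists_exp_bound hM hH (isCompact_singleton (x := 0))
    (Ω := Set.univ) fun _ _ => ⟨0, rfl, rfl⟩
  exact ⟨c, hc, lam, hlam, fun T x hx => hb T x hx fun _ _ => trivial⟩

theorem GlobExpStable.expStable {X : Type*} [NormedAddCommGroup X] [NormedSpace ℝ X] {f : X → X}
    (h : GlobExpStable f) : ExpStable f := by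
  obtain ⟨c, hc, lam, hlam, hb⟩ := h
  exact ⟨1, one_pos, c, hc, lam, hlam, fun T x hx _ => hb T x hx⟩

end ClosedLoop

/-- The converse always lands in the oscillatory alternative: for a controllable system the quotient
is zero and the condition is vacuous. -/
theorem controllable_or_oscillatory_iff {n m : ℕ} {M : Matrix (Fin n) (Fin n) ℝ} (hM : M.PosDef)
    {V : QuadraticForm ℝ (Vec n)} {G : Matrix (Fin n) (Fin m) ℝ} :
    (Controllable (linHamField M V G) ∨
      Oscillatory (uncontrollableDynamics (stateMap M V) (inputMap G))) ↔
    NoHiddenMode M (hess V) G (Set.Iic 0) := by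
  refine ⟨?_, fun h => Or.inr (h.oscillatory hM)⟩
  rintro (h | h)
  · exact fun e _ => (controllable_iff_noHiddenMode hM).1 h e (Set.mem_univ e)
  · exact noHiddenMode_of_oscillatory hM h

end IDAPBC

end

open IDAPBC in
theorem mainTheorem2 {n m : ℕ} (M : Matrix (Fin n) (Fin n) ℝ) (hM : M.PosDef)
    (V : QuadraticForm ℝ (Vec n)) (G : Matrix (Fin n) (Fin m) ℝ) (hG : G.rank = m) :
    -- transformability, with `Kv` a smooth function of `q` and with `Kv` constant
    ((∃ Mhat Vhat Kv, TransformsTo M V G Mhat Vhat Kv) ↔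
      (Controllable (linHamField M V G) ∨
        Oscillatory (uncontrollableDynamics (stateMap M V) (inputMap G)))) ∧
    ((∃ Mhat Vhat, ∃ K : Matrix (Fin m) (Fin m) ℝ, TransformsTo M V G Mhat Vhat (fun _ => K)) ↔
      (Controllable (linHamField M V G) ∨
        Oscillatory (uncontrollableDynamics (stateMap M V) (inputMap G)))) ∧
    -- exponential stability of every closed loop so obtained
    (∀ Mhat Vhat Kv, TransformsTo M V G Mhat Vhat Kv →
      (ExpStable (linDesiredField M G Mhat Vhat Kv) ↔ Controllable (linHamField M V G))) ∧
    (∀ Mhat Vhat, ∀ K : Matrix (Fin m) (Fin m) ℝ, TransformsTo M V G Mhat Vhat (fun _ => K) →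
      (GlobExpStable (linDesiredField M G Mhat Vhat (fun _ => K)) ↔
        Controllable (linHamField M V G))) := by
  rw [controllable_or_oscillatory_iff hM, controllable_iff_noHiddenMode hM]
  refine ⟨⟨fun ⟨_, _, _, h⟩ => h.noHiddenMode hM, fun h => ?_⟩,
    ⟨fun ⟨_, _, _, h⟩ => h.noHiddenMode hM, exists_transformsTo hM⟩,
    fun _ _ _ h => ⟨h.noHiddenMode_of_expStable hM, h.expStable hM⟩,
    fun _ _ _ h => ⟨fun hs => h.noHiddenMode_of_expStable hM hs.expStable, h.globExpStable hM⟩⟩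
  obtain ⟨Mhat, Vhat, K, hT⟩ := exists_transformsTo hM h
  exact ⟨Mhat, Vhat, _, hT⟩
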